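/- A graph $\Gamma=(V,E)$ consists of a finite set $V$ and a set $E$ of subsets of $V$ of size one (loops) or two; $\Gamma^-$ is $\Gamma$ with all loops deleted. The graph monoid $\mathbb{M}\Gamma$ is the monoid with generators $a_v,\bar a_v$ ($v\in V$) and relations $a_v\bar a_v=1$ for $v\in V$, and $xy=yx$ for all $x\in\{a_v,\bar a_v\}$, $y\in\{a_w,\bar a_w\}$ with $\{v,w\}\in E$ (here $v=w$ is allowed). For a monoid $M$ and a finite alphabet $X$, a valence automaton over $M$ has a finite set $Q$ of states, a finite set of edges in $Q\times X^*\times M\times Q$, an initial state $q_0$ and a set of final states. An edge $(q,x,n,q')$ leads from a configuration $(q,w,m)$ to $(q',wx,mn)$, and a word $w\in X^*$ is accepted if some configuration $(f,w,1)$ with $f$ final is reachable from $(q_0,\varepsilon,1)$. $\mathsf{VA}(M)$ is the class of languages accepted by valence automata over $M$. **Theorem.** Let $\Gamma$ be a graph such that $\Gamma^-$ contains the cycle $\mathsf{C4}$ or the path $\mathsf{P4}$ on four vertices as an induced subgraph. Then $\mathsf{VA}(\mathbb{M}\Gamma)$ is exactly the class of recursively enumerable languages (over finite alphabets), and this equality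 is effective: from a valence automaton over $\mathbb{M}\Gamma$ (with storage elements given as words over the generators) one can compute a program that semi-decides its language, and from an alphabet and a program that semi-decides a language over it one can compute a valence automaton over $\mathbb{M}\Gamma$ that accepts this language. In particular, the problem whether a given valence automaton over $\mathbb{M}\Gamma$ accepts the empty language is undecidable, even for every fixed finite input alphabet. -/

import Mathlib

universe u v w

/-- An undirected graph on the vertex set `V` without multiple edges, in which loops are allowed:
`Γ.Adj v w` says that `{v, w}` is an edge, and `Γ.Adj v v` that `v` is looped. -/
structure LoopGraph (V : Type u) where
  Adj : V → V → Prop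
  symm : ∀ v w, Adj v w → Adj w v

namespace LoopGraph

/-- The graph `Γ⁻` obtained from `Γ` by deleting all loops. -/
def deleteLoops {V : Type u} (Γ : LoopGraph V) : SimpleGraph V where
  Adj v w := v ≠ w ∧ Γ.Adj v w
  symm := ⟨fun v w h => ⟨h.1.symm, Γ.symm v w h.2⟩⟩
  loopless := ⟨fun _ h => h.1 rfl⟩

/-- The defining relations of the graph monoid. The letter `(v, true)` is the generator `a_v`, and
`(v, false)` is the generator `ā_v`. -/
inductive Rel {V : Type u} (Γ : LoopGraph V) :
    FreeMonoid (V × Bool) → FreeMonoid (V × Bool) → Prop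
  | cancel (v : V) : Rel Γ (FreeMonoid.of (v, true) * FreeMonoid.of (v, false)) 1
  | comm (v w : V) (s t : Bool) (h : Γ.Adj v w) :
      Rel Γ (FreeMonoid.of (v, s) * FreeMonoid.of (w, t))
        (FreeMonoid.of (w, t) * FreeMonoid.of (v, s))

/-- The graph monoid `𝕄Γ`: the quotient of the free monoid over `{a_v, ā_v | v ∈ V}` by the
smallest congruence containing the relations. -/
abbrev GraphMonoid {V : Type u} (Γ : LoopGraph V) : Type u := PresentedMonoid Γ.Rel

/-- The element of the graph monoid represented by a word over the generators. -/
def wordClass {V : Type u} (Γ : LoopGraph V) (g : List (V × Bool)) : Γ.GraphMonoid :=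
  PresentedMonoid.mk Γ.Rel (FreeMonoid.ofList g)

end LoopGraph

/-- A valence automaton over the monoid `M` with input alphabet `X`. -/
structure ValenceAutomaton (X : Type v) (M : Type w) where
  State : Type
  finite_state : Finite State
  edges : Set (State × List X × M × State)
  finite_edges : edges.Finite
  init : State
  final : Set State

namespace ValenceAutomaton

variable {X : Type v} {M : Type w} [Monoid M]

/-- One step between configurations (state, input read so far, storage content). -/
def Step (A : ValenceAutomaton X M) (c c' : A.State × List X × M) : Prop :=
  ∃ (x : List X) (n : M), (c.1, x, n, c'.1) ∈ A.edges ∧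
    c'.2.1 = c.2.1 ++ x ∧ c'.2.2 = c.2.2 * n

/-- The accepted language. -/
def language (A : ValenceAutomaton X M) : Language X :=
  {x | ∃ f ∈ A.final, Relation.ReflTransGen A.Step (A.init, [], 1) (f, x, 1)}

end ValenceAutomaton

/-- The languages over the alphabet `X` that are accepted by valence automata over `M`. -/
def VA (M : Type w) [Monoid M] (X : Type v) : Set (Language X) :=
  {L | ∃ A : ValenceAutomaton X M, A.language = L}

/-- A finite description of a valence automaton over a graph monoid. The states are the numbers
`0, …, lastState`, the initial state is `0`, letters of the input alphabet are given as numbers,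
and storage elements are given by words over the generators. -/
structure ValenceCode (V : Type u) where
  lastState : ℕ
  edges : List (ℕ × List ℕ × List (V × Bool) × ℕ)
  final : List ℕ

namespace ValenceCode

/-- A description is a triple of finite data. -/
def equivProd (V : Type u) :
    ValenceCode V ≃ ℕ × List (ℕ × List ℕ × List (V × Bool) × ℕ) × List ℕ where
  toFun c := (c.lastState, c.edges, c.final)
  invFun p := ⟨p.1, p.2.1, p.2.2⟩
  left_inv _ := rfl
  right_inv _ := rfl

instance {V : Type u} [Primcodable V] : Primcodable (ValenceCode V) :=
  Primcodable.ofEquiv _ (equivProd V)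

/-- The edges of the described automaton over the alphabet `Fin k`. Listed edges that mention a
state or a letter out of range are ignored. -/
def edgeSet {V : Type u} (Γ : LoopGraph V) (k : ℕ) (c : ValenceCode V) :
    Set (Fin (c.lastState + 1) × List (Fin k) × Γ.GraphMonoid × Fin (c.lastState + 1)) :=
  {e | ∃ g : List (V × Bool),
    (e.1.val, e.2.1.map Fin.val, g, e.2.2.2.val) ∈ c.edges ∧ e.2.2.1 = Γ.wordClass g}

theorem edgeSet_finite {V : Type u} (Γ : LoopGraph V) (k : ℕ) (c : ValenceCode V) :
    (c.edgeSet Γ k).Finite := by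
  have hfin : ((fun e : ℕ × List ℕ × List (V × Bool) × ℕ =>
      (e.1, e.2.1, Γ.wordClass e.2.2.1, e.2.2.2)) '' {e | e ∈ c.edges}).Finite :=
    (List.finite_toSet c.edges).image _
  refine Set.Finite.of_finite_image (f := fun e =>
    (e.1.val, e.2.1.map Fin.val, e.2.2.1, e.2.2.2.val)) (hfin.subset ?_) ?_
  · rintro _ ⟨⟨p, x, m, q⟩, ⟨g, hg, hm⟩, rfl⟩
    exact ⟨_, hg, by simpa using hm.symm⟩
  · rintro ⟨p, x, m, q⟩ - ⟨p', x', m', q'⟩ - h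
    simp only [Prod.mk.injEq] at h
    obtain ⟨h1, h2, h3, h4⟩ := h
    rw [Fin.ext h1, List.map_injective_iff.2 Fin.val_injective h2, h3, Fin.ext h4]

/-- The described valence automaton over `𝕄Γ` with input alphabet `Fin k`. -/
def toAutomaton {V : Type u} (Γ : LoopGraph V) (k : ℕ) (c : ValenceCode V) :
    ValenceAutomaton (Fin k) Γ.GraphMonoid where
  State := Fin (c.lastState + 1)
  finite_state := inferInstance
  edges := c.edgeSet Γ k
  finite_edges := c.edgeSet_finite Γ k
  init := 0
  final := {q | q.val ∈ c.final}

end ValenceCode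

/-- The recursively enumerable language over the alphabet `Fin k` represented by the program `c`:
the words on which `c` halts. -/
def reLanguage (k : ℕ) (c : Nat.Partrec.Code) : Language (Fin k) :=
  {x | (c.eval (Encodable.encode (x.map Fin.val))).Dom}

/-!
An induced `C4` or `P4` yields vertices `p`, `q`, `r`, `s` such that neither `p`, `q` nor `s`, `r`
are adjacent, while `p` commutes with `r` and `s`, and `q` commutes with `s`. A sequence of moves
from `mᵢ` to `nᵢ` is stored as the product of the words `s ^ mᵢ p ^ nᵢ r q`. The blocks `p ^ nᵢ q`
and the blocks `s ^ mᵢ r` generate free monoids, so that multiplying by a product of words `s̄ p̄`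
and `r̄ q̄` gives `1` exactly if each move starts where the previous one ended. As the moves from
`a t + b` to `c t + d`, with `t` arbitrary, form a rational set, a valence automaton can simulate a
machine that stores one number and applies such affine instructions. Through Gödel's encoding by
prime powers, this number holds any finite number of registers, which suffices for a universal
machine.

Conversely, the runs of a valence automaton whose storage contents are words over the generators,
and in which the defining relations may be applied at any time, can be enumerated.
-/

/-! ### Uniformly rational families -/

section UniformlyRational

open Pointwise

variable {ι α : Type*} {N : Type*} [Primcodable ι] [Primcodable α] [Monoid N]

/-- Families `F` of subsets of a monoid that are given by one rational expression whose atoms are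
finite sets, such that lists of labels for the atoms of `F i` are primitive recursive in `i`. A
label `a` stands for the element `ev a`. -/
inductive UniformlyRational (ev : α → N) : (ι → Set N) → Prop
  | atom {σ : ι → List α} (hσ : Primrec σ) : UniformlyRational ev fun i => ev '' {a | a ∈ σ i}
  | mul {F G : ι → Set N} (hF : UniformlyRational ev F) (hG : UniformlyRational ev G) :
      UniformlyRational ev fun i => F i * G i
  | star {F : ι → Set N} (hF : UniformlyRational ev F) :
      UniformlyRational ev fun i => (Submonoid.closure (F i) : Set N)

/-- A finite directed graph on vertices in `ℕ` each of whose edges carries a finite set of labels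
that is primitive recursive in a parameter `i : ι`. -/
abbrev LabelledGraph (ι α : Type*) [Primcodable ι] [Primcodable α] : Type _ :=
  List (ℕ × {σ : ι → List α // Primrec σ} × ℕ)

namespace LabelledGraph

/-- `x` is the product of the values of labels along a walk from the vertex `0` to the vertex
`q`. -/
inductive HasProduct (E : LabelledGraph ι α) (ev : α → N) (i : ι) : ℕ → N → Prop
  | one : HasProduct E ev i 0 1
  | mul_label {p q : ℕ} {σ : {σ : ι → List α // Primrec σ}} {a : α} {x : N}
      (hx : HasProduct E ev i p x) (he : (p, σ, q) ∈ E) (ha : a ∈ σ.1 i) :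
      HasProduct E ev i q (x * ev a)

/-- The edge from `p` to `q` that carries the single label `a`. -/
def edge (p : ℕ) (a : α) (q : ℕ) : ℕ × {σ : ι → List α // Primrec σ} × ℕ :=
  (p, ⟨fun _ => [a], Primrec.const _⟩, q)

/-- The graph with the vertices renamed by `f`. -/
def rename (f : ℕ → ℕ) (E : LabelledGraph ι α) : LabelledGraph ι α :=
  E.map fun e => (f e.1, e.2.1, f e.2.2)

variable {E : LabelledGraph ι α} {ev : α → N} {i : ι}

theorem HasProduct.of_edge {p q : ℕ} {ε : α} {x : N} (hx : E.HasProduct ev i p x)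
    (he : edge p ε q ∈ E) (hε : ev ε = 1) : E.HasProduct ev i q x := by
  simpa only [hε, mul_one] using hx.mul_label he (List.mem_singleton_self ε)

theorem HasProduct.mul_of_rename {E' : LabelledGraph ι α} {f : ℕ → ℕ} {x y : N} {q : ℕ}
    (hx : E'.HasProduct ev i (f 0) x) (hy : E.HasProduct ev i q y) (hE : E.rename f ⊆ E') :
    E'.HasProduct ev i (f q) (x * y) := by
  induction hy with
  | one => rwa [mul_one]
  | mul_label _ he ha ih =>
    rw [← mul_assoc]
    exact ih.mul_label (hE (List.mem_map.2 ⟨_, he, rfl⟩)) ha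

theorem mem_rename {f : ℕ → ℕ} {p q : ℕ} {σ : {σ : ι → List α // Primrec σ}} :
    (p, σ, q) ∈ E.rename f ↔ ∃ p' q', (p', σ, q') ∈ E ∧ p = f p' ∧ q = f q' := by
  simp only [rename, List.mem_map, Prod.mk.injEq, Prod.exists]
  exact ⟨fun ⟨p', _, q', h, h₁, h₂, h₃⟩ => ⟨p', q', h₂ ▸ h, h₁.symm, h₃.symm⟩,
    fun ⟨p', q', h, h₁, h₂⟩ => ⟨p', σ, q', h, h₁.symm, rfl, h₂.symm⟩⟩

theorem exists_hasProduct_iff_image (σ : {σ : ι → List α // Primrec σ}) :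
    ∃ (E : LabelledGraph ι α) (f : ℕ), ∀ i x,
      E.HasProduct ev i f x ↔ x ∈ ev '' {a | a ∈ σ.1 i} := by
  refine ⟨[(0, σ, 1)], 1, fun i x => ⟨fun hx => ?_, ?_⟩⟩
  · have invariant (q : ℕ) (x : N) (hx : HasProduct [(0, σ, 1)] ev i q x) :
        q = 0 ∧ x = 1 ∨ q = 1 ∧ x ∈ ev '' {a | a ∈ σ.1 i} := by
      induction hx with
      | one => exact .inl ⟨rfl, rfl⟩
      | @mul_label _ _ _ a _ _ he ha ih =>
        simp only [List.mem_singleton, Prod.mk.injEq] at he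
        obtain ⟨rfl, rfl, rfl⟩ := he
        obtain ⟨-, rfl⟩ | ⟨h, -⟩ := ih
        · exact .inr ⟨rfl, a, ha, (one_mul _).symm⟩
        · omega
    exact ((invariant _ _ hx).resolve_left (by simp)).2
  · rintro ⟨a, ha, rfl⟩
    simpa using (HasProduct.one (E := [(0, σ, 1)]) (ev := ev)).mul_label List.mem_cons_self ha

theorem exists_hasProduct_iff_mul {ε : α} (hε : ev ε = 1) (E₁ E₂ : LabelledGraph ι α)
    (f₁ f₂ : ℕ) : ∃ (E : LabelledGraph ι α) (f : ℕ), ∀ i x, E.HasProduct ev i f x ↔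
      ∃ y z, E₁.HasProduct ev i f₁ y ∧ E₂.HasProduct ev i f₂ z ∧ y * z = x := by
  let E : LabelledGraph ι α :=
    edge (2 * f₁) ε 1 :: (E₁.rename (2 * ·) ++ E₂.rename (2 * · + 1))
  refine ⟨E, 2 * f₂ + 1, fun i x => ⟨fun h => ?_, ?_⟩⟩
  · have invariant (q : ℕ) (x : N) (h : E.HasProduct ev i q x) :
        (∃ n, q = 2 * n ∧ E₁.HasProduct ev i n x) ∨ ∃ n, q = 2 * n + 1 ∧
          ∃ y z, E₁.HasProduct ev i f₁ y ∧ E₂.HasProduct ev i n z ∧ y * z = x := by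
      induction h with
      | one => exact .inl ⟨0, rfl, .one⟩
      | @mul_label _ _ _ a x _ he ha ih =>
        simp only [E, List.mem_cons, edge, Prod.mk.injEq, List.mem_append, mem_rename] at he
        obtain ⟨rfl, rfl, rfl⟩ | ⟨p, q, he, rfl, rfl⟩ | ⟨p, q, he, rfl, rfl⟩ := he <;>
          obtain ⟨n, hn, hx⟩ | ⟨n, hn, y, z, hy, hz, rfl⟩ := ih <;> try omega
        · rw [List.mem_singleton.1 ha, hε, mul_one]
          obtain rfl : n = f₁ := by omega
          exact .inr ⟨0, rfl, x, 1, hx, .one, mul_one x⟩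
        · obtain rfl : n = p := by omega
          exact .inl ⟨q, rfl, hx.mul_label he ha⟩
        · obtain rfl : n = p := by omega
          exact .inr ⟨q, rfl, y, z * ev a, hy, hz.mul_label he ha, (mul_assoc ..).symm⟩
    obtain ⟨n, hn, -⟩ | ⟨n, hn, hx⟩ := invariant _ _ h
    · omega
    · rwa [show n = f₂ by omega] at hx
  · rintro ⟨y, z, hy, hz, rfl⟩
    refine HasProduct.mul_of_rename (f := (2 * · + 1)) ?_ hz fun e he => by simp [E, he]
    refine HasProduct.of_edge ?_ List.mem_cons_self hε
    simpa only [one_mul] using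
      HasProduct.one.mul_of_rename (f := (2 * ·)) hy fun e he => by simp [E, he]

theorem exists_hasProduct_iff_mem_closure {ε : α} (hε : ev ε = 1) (E : LabelledGraph ι α)
    (f : ℕ) : ∃ (E' : LabelledGraph ι α) (f' : ℕ), ∀ i x,
      E'.HasProduct ev i f' x ↔ x ∈ Submonoid.closure {y | E.HasProduct ev i f y} := by
  let E' : LabelledGraph ι α := edge 0 ε 1 :: edge (f + 1) ε 0 :: E.rename (· + 1)
  refine ⟨E', 0, fun i x => ⟨fun hx => ?_, fun hx => ?_⟩⟩
  · have invariant (q : ℕ) (x : N) (hx : E'.HasProduct ev i q x) :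
        (q = 0 ∧ x ∈ Submonoid.closure {y | E.HasProduct ev i f y}) ∨ ∃ n, q = n + 1 ∧
          ∃ y z, y ∈ Submonoid.closure {y | E.HasProduct ev i f y} ∧
            E.HasProduct ev i n z ∧ y * z = x := by
      induction hx with
      | one => exact .inl ⟨rfl, one_mem _⟩
      | @mul_label _ _ _ a x _ he ha ih =>
        simp only [E', List.mem_cons, edge, Prod.mk.injEq, mem_rename] at he
        obtain ⟨rfl, rfl, rfl⟩ | ⟨rfl, rfl, rfl⟩ | ⟨p, q, he, rfl, rfl⟩ := he <;>
          obtain ⟨h, hx⟩ | ⟨n, hn, y, z, hy, hz, rfl⟩ := ih <;> try omega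
        · rw [List.mem_singleton.1 ha, hε, mul_one]
          exact .inr ⟨0, rfl, x, 1, hx, .one, mul_one x⟩
        · rw [List.mem_singleton.1 ha, hε, mul_one]
          obtain rfl : n = f := by omega
          exact .inl ⟨rfl, mul_mem hy (Submonoid.subset_closure hz)⟩
        · obtain rfl : n = p := by omega
          exact .inr ⟨q, rfl, y, z * ev a, hy, hz.mul_label he ha, (mul_assoc ..).symm⟩
    exact ((invariant _ _ hx).resolve_right (by simp)).2
  · induction hx using Submonoid.closure_induction_right with
    | one => exact .one
    | mul_right x _ y hy ih =>
      refine HasProduct.of_edge ?_ (List.mem_cons_of_mem _ List.mem_cons_self) hε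
      exact HasProduct.mul_of_rename (f := (· + 1)) (ih.of_edge List.mem_cons_self hε) hy
        fun e he => by simp [E', he]

end LabelledGraph

theorem UniformlyRational.exists_labelledGraph {ev : α → N} {ε : α} (hε : ev ε = 1)
    {F : ι → Set N} (hF : UniformlyRational ev F) :
    ∃ (E : LabelledGraph ι α) (f : ℕ), ∀ i x, E.HasProduct ev i f x ↔ x ∈ F i := by
  induction hF with
  | atom hσ => exact LabelledGraph.exists_hasProduct_iff_image ⟨_, hσ⟩
  | mul _ _ hF hG =>
    obtain ⟨E₁, f₁, h₁⟩ := hF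
    obtain ⟨E₂, f₂, h₂⟩ := hG
    simpa only [h₁, h₂, Set.mem_mul, exists_and_left] using
      LabelledGraph.exists_hasProduct_iff_mul hε E₁ E₂ f₁ f₂
  | star _ hF =>
    obtain ⟨E, f, h⟩ := hF
    simpa only [h, Set.ofPred_mem_eq, SetLike.mem_coe] using
      LabelledGraph.exists_hasProduct_iff_mem_closure hε E f

end UniformlyRational

/-! ### Valence automata from rational families -/

section ValenceCode

open Relation

variable {ι : Type*} {V : Type u} [Primcodable ι]

namespace LoopGraph

variable (Γ : LoopGraph V)

/-- The element of `X* × 𝕄Γ` that is read and multiplied by an edge of a valence automaton. -/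
def labelValue (a : List ℕ × List (V × Bool)) : FreeMonoid ℕ × Γ.GraphMonoid :=
  (FreeMonoid.ofList a.1, Γ.wordClass a.2)

theorem labelValue_nil : Γ.labelValue ([], []) = 1 := rfl

end LoopGraph

variable [Primcodable V]

namespace LabelledGraph

/-- The description of the valence automaton with the edges of `E`, initial state `0` and final
state `f`. -/
def toValenceCode (E : LabelledGraph ι (List ℕ × List (V × Bool))) (f : ℕ) (i : ι) :
    ValenceCode V where
  lastState := f + (E.map fun e => e.1 + e.2.2).sum
  edges := E.flatMap fun e => (e.2.1.1 i).map fun a => (e.1, a.1, a.2, e.2.2)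
  final := [f]

variable {E : LabelledGraph ι (List ℕ × List (V × Bool))} {f : ℕ} {i : ι}

theorem mem_edges_toValenceCode {p q : ℕ} {y : List ℕ} {g : List (V × Bool)} :
    (p, y, g, q) ∈ (E.toValenceCode f i).edges ↔ ∃ σ, (p, σ, q) ∈ E ∧ (y, g) ∈ σ.1 i := by
  simp only [toValenceCode, List.mem_flatMap, List.mem_map, Prod.mk.injEq, Prod.exists]
  exact ⟨fun ⟨_, σ, _, he, _, _, ha, h₁, h₂, h₃, h₄⟩ => ⟨σ, by rwa [← h₁, ← h₄],
    by rwa [← h₂, ← h₃]⟩, fun ⟨σ, he, ha⟩ => ⟨p, σ, q, he, y, g, ha, rfl, rfl, rfl, rfl⟩⟩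

theorem le_lastState_toValenceCode {p q : ℕ} {σ : {σ : ι → List _ // Primrec σ}}
    (he : (p, σ, q) ∈ E) : q ≤ (E.toValenceCode f i).lastState := by
  have : p + q ≤ (E.map fun e => e.1 + e.2.2).sum :=
    List.single_le_sum (fun _ _ => Nat.zero_le _) _ (List.mem_map.2 ⟨_, he, rfl⟩)
  simp only [toValenceCode]
  omega

theorem reflTransGen_step_toValenceCode (Γ : LoopGraph V) {k : ℕ} {q : ℕ}
    {n : FreeMonoid ℕ × Γ.GraphMonoid} (h : E.HasProduct Γ.labelValue i q n) (x : List (Fin k))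
    (hx : FreeMonoid.ofList (x.map Fin.val) = n.1) :
    ∃ hq : q < (E.toValenceCode f i).lastState + 1,
      ReflTransGen ((E.toValenceCode f i).toAutomaton Γ k).Step
        ((0 : Fin _), [], 1) ((⟨q, hq⟩ : Fin _), x, n.2) := by
  induction h generalizing x with
  | one =>
    obtain rfl : x = [] := List.map_eq_nil_iff.1 hx
    exact ⟨Nat.succ_pos _, .refl⟩
  | @mul_label p q σ a n _ he ha ih =>
    obtain ⟨x₁, x₂, rfl, h₁, h₂⟩ := List.map_eq_append_iff.1 hx
    obtain ⟨_, hr⟩ := ih x₁ h₁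
    refine ⟨Nat.lt_succ_of_le (le_lastState_toValenceCode he), hr.tail ⟨x₂, _, ⟨a.2, ?_, rfl⟩,
      rfl, rfl⟩⟩
    exact mem_edges_toValenceCode.2 ⟨σ, he, by rwa [h₂]⟩

theorem hasProduct_of_reflTransGen_step (Γ : LoopGraph V) {k : ℕ}
    {c : Fin ((E.toValenceCode f i).lastState + 1) × List (Fin k) × Γ.GraphMonoid}
    (h : ReflTransGen ((E.toValenceCode f i).toAutomaton Γ k).Step ((0 : Fin _), [], 1) c) :
    E.HasProduct Γ.labelValue i c.1.val (FreeMonoid.ofList (c.2.1.map Fin.val), c.2.2) := by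
  induction h with
  | refl => exact .one
  | @tail c c' _ hs ih =>
    obtain ⟨y, n, ⟨g, hg, hn⟩, hx, hm⟩ := hs
    obtain ⟨σ, he, ha⟩ := mem_edges_toValenceCode.1 hg
    simp only at hn
    rw [hx, hm, hn, List.map_append, FreeMonoid.ofList_append]
    exact ih.mul_label he ha

theorem mem_language_toValenceCode (Γ : LoopGraph V) {k : ℕ} {x : List (Fin k)} :
    x ∈ ((E.toValenceCode f i).toAutomaton Γ k).language ↔
      E.HasProduct Γ.labelValue i f (FreeMonoid.ofList (x.map Fin.val), 1) := by
  constructor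
  · rintro ⟨q, hq, h⟩
    rw [← show q.val = f from List.mem_singleton.1 hq]
    exact hasProduct_of_reflTransGen_step Γ h
  · exact fun h => ⟨_, List.mem_singleton_self _, (reflTransGen_step_toValenceCode Γ h x rfl).2⟩

theorem primrec_toValenceCode : Primrec (E.toValenceCode f) := by
  have edges : Primrec fun i => (E.toValenceCode f i).edges := by
    unfold toValenceCode
    induction E with
    | nil => exact Primrec.const []
    | cons e E ih =>
      simp only [List.flatMap_cons]
      refine Primrec.list_append.comp (Primrec.list_map e.2.1.2 (Primrec.pair (Primrec.const _)
        (Primrec.pair (Primrec.fst.comp Primrec.snd) (Primrec.pair (Primrec.snd.comp Primrec.snd)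
          (Primrec.const _)))).to₂) ih
  exact (Primrec.of_equiv_symm (e := ValenceCode.equivProd V)).comp
    (Primrec.pair (Primrec.const _) (Primrec.pair edges (Primrec.const _)))

end LabelledGraph

theorem UniformlyRational.exists_valenceCode {Γ : LoopGraph V}
    {F : ι → Set (FreeMonoid ℕ × Γ.GraphMonoid)} (hF : UniformlyRational Γ.labelValue F) :
    ∃ g : ι → ValenceCode V, Primrec g ∧ ∀ i k, ((g i).toAutomaton Γ k).language =
      {x : List (Fin k) | (FreeMonoid.ofList (x.map Fin.val), 1) ∈ F i} := by
  obtain ⟨E, f, h⟩ := hF.exists_labelledGraph Γ.labelValue_nil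
  exact ⟨E.toValenceCode f, LabelledGraph.primrec_toValenceCode, fun i k =>
    Set.ext fun x => (LabelledGraph.mem_language_toValenceCode Γ).trans (h i _)⟩

end ValenceCode

/-! ### Machines with a single number as storage -/

section AffineRealizable

open Relation

/-- A configuration of a machine with a single number as storage: the input read so far and the
number. -/
abbrev NumConf : Type := List ℕ × ℕ

/-- Families of relations between configurations that are composed, by relational composition and
reflexive transitive closure, of instructions replacing a number `a * t + b` by `c * t + d`, for an
arbitrary `t`, while reading a word `y`. The slopes `a` and `c` and the finite set of possible
triples `(y, b, d)` are primitive recursive in the parameter `i`. -/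
inductive AffineRealizable {ι : Type*} [Primcodable ι] : (ι → NumConf → NumConf → Prop) → Prop
  | affine {a c : ι → ℕ} {σ : ι → List (List ℕ × ℕ × ℕ)} (ha : Primrec a) (hc : Primrec c)
      (hσ : Primrec σ) : AffineRealizable fun i x x' =>
        ∃ e ∈ σ i, ∃ t, x.2 = a i * t + e.2.1 ∧ x' = (x.1 ++ e.1, c i * t + e.2.2)
  | comp {R S : ι → NumConf → NumConf → Prop} (hR : AffineRealizable R)
      (hS : AffineRealizable S) : AffineRealizable fun i => Comp (R i) (S i)
  | star {R : ι → NumConf → NumConf → Prop} (hR : AffineRealizable R) :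
      AffineRealizable fun i => ReflTransGen (R i)

theorem AffineRealizable.comp_primrec {ι κ : Type*} [Primcodable ι] [Primcodable κ]
    {R : ι → NumConf → NumConf → Prop} (hR : AffineRealizable R) {f : κ → ι} (hf : Primrec f) :
    AffineRealizable fun j => R (f j) := by
  induction hR with
  | affine ha hc hσ => exact .affine (ha.comp hf) (hc.comp hf) (hσ.comp hf)
  | comp _ _ hR hS => exact .comp hR hS
  | star _ hR => exact .star hR

/-- A move `(y, m, n)` reads the word `y` and replaces the number `m` by `n`. -/
abbrev Move : Type := List ℕ × ℕ × ℕ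

/-- The moves in the list lead, one after the other, from `c` to `c'`. -/
def Follows : List Move → NumConf → NumConf → Prop
  | [], c, c' => c = c'
  | m :: t, c, c' => c.2 = m.2.1 ∧ Follows t (c.1 ++ m.1, m.2.2) c'

theorem follows_singleton {m : Move} {c c' : NumConf} :
    Follows [m] c c' ↔ c.2 = m.2.1 ∧ c' = (c.1 ++ m.1, m.2.2) := by
  simp only [Follows, eq_comm]

theorem follows_append {t t' : List Move} {c c' : NumConf} :
    Follows (t ++ t') c c' ↔ Comp (Follows t) (Follows t') c c' := by
  induction t generalizing c with
  | nil => simp [Follows, Comp]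
  | cons m t ih => simp only [List.cons_append, Follows, ih, Comp, ← exists_and_left, and_assoc]

theorem reflTransGen_iff_follows {R : NumConf → NumConf → Prop} {T : Set (FreeMonoid Move)}
    (hR : ∀ c c', R c c' ↔ ∃ t ∈ T, Follows t.toList c c') {c c' : NumConf} :
    ReflTransGen R c c' ↔ ∃ t ∈ Submonoid.closure T, Follows t.toList c c' := by
  constructor
  · intro h
    induction h with
    | refl => exact ⟨1, one_mem _, rfl⟩
    | tail _ h ih =>
      obtain ⟨t, ht, htd⟩ := ih
      obtain ⟨u, hu, hud⟩ := (hR _ _).1 h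
      exact ⟨t * u, mul_mem ht (Submonoid.subset_closure hu), follows_append.2 ⟨_, htd, hud⟩⟩
  · rintro ⟨t, ht, h⟩
    induction ht using Submonoid.closure_induction generalizing c c' with
    | mem t ht => exact .single ((hR _ _).2 ⟨t, ht, h⟩)
    | one => exact (h : c = c') ▸ .refl
    | mul t u _ _ iht ihu =>
      obtain ⟨d, htd, hud⟩ := follows_append.1 h
      exact (iht htd).trans (ihu hud)

theorem follows_iff {t : List Move} {c c' : NumConf} :
    Follows t c c' ↔ c'.1 = c.1 ++ (t.map fun m => m.1).flatten ∧
      c.2 :: t.map (fun m => m.2.2) = t.map (fun m => m.2.1) ++ [c'.2] := by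
  induction t generalizing c with
  | nil => simp [Follows, Prod.ext_iff, eq_comm]
  | cons m t ih => simp [Follows, ih, and_left_comm]

end AffineRealizable

/-! ### Free groups and graph monoids -/

section FreeGroup

/-- The product of the words `a ^ n * b` over the numbers `n` in the list. -/
def blockProd (l : List ℕ) : FreeGroup Bool :=
  (l.map fun n => FreeGroup.of true ^ n * FreeGroup.of false).prod

/-- The reduced word that represents `blockProd`. -/
def blockWord : List ℕ → List (Bool × Bool)
  | [] => []
  | 0 :: l => (false, true) :: blockWord l
  | (n + 1) :: l => (true, true) :: blockWord (n :: l)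

theorem mk_blockWord (l : List ℕ) : FreeGroup.mk (blockWord l) = blockProd l := by
  have mk_cons (x : Bool) (w) : FreeGroup.mk ((x, true) :: w) = .of x * .mk w :=
    (FreeGroup.mul_mk (L₁ := [(x, true)])).symm
  induction l using blockWord.induct with
  | case1 => simp [blockWord, blockProd, FreeGroup.one_eq_mk]
  | case2 l ih => simp [blockWord, blockProd, mk_cons, ih]
  | case3 n l ih => simp [blockWord, blockProd, mk_cons, ih, pow_succ', mul_assoc]

theorem isReduced_blockWord (l : List ℕ) : FreeGroup.IsReduced (blockWord l) := by
  have snd_eq_true : ∀ x ∈ blockWord l, x.2 = true := by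
    induction l using blockWord.induct <;> simp_all [blockWord]
  exact List.Pairwise.isChain <| List.pairwise_of_forall_mem_list
    fun x hx y hy _ => (snd_eq_true x hx).trans (snd_eq_true y hy).symm

theorem blockWord_injective : Function.Injective blockWord := by
  intro l l' h
  induction l using blockWord.induct generalizing l' with
  | case1 => rcases l' with _ | ⟨_ | m, l'⟩ <;> simp_all [blockWord]
  | case2 l ih =>
    rcases l' with _ | ⟨_ | m, l'⟩
    · simp [blockWord] at h
    · rw [ih (by simpa [blockWord] using h)]
    · simp [blockWord] at h
  | case3 n l ih =>
    rcases l' with _ | ⟨_ | m, l'⟩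
    · simp [blockWord] at h
    · simp [blockWord] at h
    · obtain ⟨rfl, rfl⟩ := List.cons.inj (ih (by simpa [blockWord] using h))
      rfl

theorem blockProd_injective : Function.Injective blockProd := by
  intro l l' h
  rw [← mk_blockWord, ← mk_blockWord] at h
  have := FreeGroup.reduce.sound h
  rw [(isReduced_blockWord l).reduce_eq, (isReduced_blockWord l').reduce_eq] at this
  exact blockWord_injective this

end FreeGroup

namespace LoopGraph

variable {V : Type u} (Γ : LoopGraph V)

open Classical in
/-- The image of a generator under `pairHom`. -/
noncomputable def pairGen (u v : V) (x : V × Bool) : FreeGroup Bool :=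
  (if x.1 = u then .of true else if x.1 = v then .of false else 1) ^ (if x.2 then (1 : ℤ) else -1)

theorem lift_pairGen_eq_of_rel {u v : V} (huv : ¬ Γ.Adj u v)
    (a b : FreeMonoid (V × Bool)) (h : Γ.Rel a b) :
    FreeMonoid.lift (pairGen u v) a = FreeMonoid.lift (pairGen u v) b := by
  cases h with
  | cancel w =>
    simp only [map_mul, map_one, FreeMonoid.lift_eval_of, pairGen, ← zpow_add]
    simp
  | comm w w' s t h =>
    have hvu : ¬ Γ.Adj v u := fun h => huv (Γ.symm _ _ h)
    simp only [map_mul, FreeMonoid.lift_eval_of, pairGen]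
    by_cases e : w = w'
    · subst e
      rw [← zpow_add, ← zpow_add, add_comm]
    · split_ifs <;> simp_all

/-- The homomorphism that maps `u` and `v` to two free generators and the other vertices to `1`. -/
noncomputable def pairHom {u v : V} (huv : ¬ Γ.Adj u v) : Γ.GraphMonoid →* FreeGroup Bool :=
  PresentedMonoid.lift (pairGen u v) (Γ.lift_pairGen_eq_of_rel huv)

/-- The generators `a_v` (for `true`) and `ā_v` (for `false`) of the graph monoid. -/
def gen (v : V) (b : Bool) : Γ.GraphMonoid := Γ.wordClass [(v, b)]

theorem pairHom_gen {u v : V} (huv : ¬ Γ.Adj u v) (w : V) (b : Bool) :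
    Γ.pairHom huv (Γ.gen w b) = pairGen u v (w, b) :=
  FreeMonoid.lift_eval_of _ _

theorem wordClass_append (g g' : List (V × Bool)) :
    Γ.wordClass (g ++ g') = Γ.wordClass g * Γ.wordClass g' :=
  map_mul (PresentedMonoid.mk Γ.Rel) _ _

theorem wordClass_cons (x : V × Bool) (g : List (V × Bool)) :
    Γ.wordClass (x :: g) = Γ.gen x.1 x.2 * Γ.wordClass g :=
  Γ.wordClass_append [x] g

theorem wordClass_pair (x y : V × Bool) :
    Γ.wordClass [x, y] = Γ.gen x.1 x.2 * Γ.gen y.1 y.2 :=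
  Γ.wordClass_append [x] [y]

theorem wordClass_replicate (n : ℕ) (v : V) (b : Bool) :
    Γ.wordClass (List.replicate n (v, b)) = Γ.gen v b ^ n := by
  induction n with
  | zero => rfl
  | succ n ih => rw [List.replicate_succ, wordClass_cons, ih, pow_succ']

theorem gen_true_mul_gen_false (v : V) : Γ.gen v true * Γ.gen v false = 1 :=
  PresentedMonoid.mk_eq_mk_of_rel (.cancel v)

theorem commute_gen {v w : V} (h : Γ.Adj v w) (b c : Bool) : Commute (Γ.gen v b) (Γ.gen w c) :=
  PresentedMonoid.mk_eq_mk_of_rel (.comm v w b c h)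

/-- Four vertices among which `r`, `p`, `s`, `q` are joined to a path; `q` and `r` may be adjacent
or not, so the vertices induce `C4` or `P4`. -/
structure IsQuad (p q r s : V) : Prop where
  adj_pr : Γ.deleteLoops.Adj p r
  adj_ps : Γ.deleteLoops.Adj p s
  adj_qs : Γ.deleteLoops.Adj q s
  not_adj_pq : ¬ Γ.deleteLoops.Adj p q
  not_adj_sr : ¬ Γ.deleteLoops.Adj s r
  ne_pq : p ≠ q
  ne_qr : q ≠ r
  ne_sr : s ≠ r

theorem exists_isQuad
    (hΓ : (SimpleGraph.cycleGraph 4).IsIndContained Γ.deleteLoops ∨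
      (SimpleGraph.pathGraph 4).IsIndContained Γ.deleteLoops) :
    ∃ p q r s, Γ.IsQuad p q r s := by
  rcases hΓ with ⟨⟨φ⟩⟩ | ⟨⟨φ⟩⟩
  · refine ⟨φ 0, φ 2, φ 1, φ 3, ?_⟩
    constructor <;> simp only [SimpleGraph.Embedding.map_adj_iff, ne_eq, φ.injective.eq_iff] <;>
      decide
  · refine ⟨φ 1, φ 3, φ 0, φ 2, ?_⟩
    constructor <;> simp [SimpleGraph.Embedding.map_adj_iff, SimpleGraph.pathGraph_adj]

end LoopGraph

/-! ### Storing a number in the graph monoid -/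

namespace LoopGraph

variable {V : Type u} {Γ : LoopGraph V} {p q r s : V}

theorem gen_true_pow_mul_gen_false_pow (Γ : LoopGraph V) (v : V) (n : ℕ) :
    Γ.gen v true ^ n * Γ.gen v false ^ n = 1 := by
  induction n with
  | zero => simp
  | succ n ih =>
    rw [pow_succ, pow_succ', mul_assoc, ← mul_assoc (Γ.gen v true), gen_true_mul_gen_false,
      one_mul, ih]

/-- The word `s ^ m * p ^ n * r * q` for the move `(y, m, n)`. -/
def moveValue (Γ : LoopGraph V) (p q r s : V) (m : Move) : Γ.GraphMonoid :=
  Γ.gen s true ^ m.2.1 * Γ.gen p true ^ m.2.2 * Γ.gen r true * Γ.gen q true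

/-- The submonoid of the words that cancel matching blocks of a queue: it is generated by
`s̄ * p̄` and `r̄ * q̄`. -/
def matcher (Γ : LoopGraph V) (p q r s : V) : Submonoid Γ.GraphMonoid :=
  .closure {Γ.gen s false * Γ.gen p false, Γ.gen r false * Γ.gen q false}

/-- The storage content after the moves in `t` if the first number is guessed to be `m` and the
last one to be `n`. -/
def queueValue (Γ : LoopGraph V) (p q r s : V) (m : ℕ) (t : List Move) (n : ℕ) : Γ.GraphMonoid :=
  Γ.gen p true ^ m * Γ.gen q true * (t.map (Γ.moveValue p q r s)).prod * Γ.gen s true ^ n *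
    Γ.gen r true

namespace IsQuad

theorem block_mul_cancel (hQ : Γ.IsQuad p q r s) (n : ℕ) :
    Γ.gen p true ^ n * Γ.gen q true * Γ.gen s true ^ n * Γ.gen r true *
      (Γ.gen r false * Γ.gen q false * (Γ.gen s false * Γ.gen p false) ^ n) = 1 := by
  have hqs : Commute (Γ.gen q true) (Γ.gen s true ^ n) :=
    (Γ.commute_gen hQ.adj_qs.2 _ _).pow_right n
  have hps : Commute (Γ.gen p true ^ n) (Γ.gen s true ^ n) :=
    (Γ.commute_gen hQ.adj_ps.2 _ _).pow_pow n n
  have hsp : Commute (Γ.gen s false) (Γ.gen p false) := (Γ.commute_gen hQ.adj_ps.2 _ _).symm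
  calc _ = Γ.gen p true ^ n * (Γ.gen q true * Γ.gen s true ^ n) *
        (Γ.gen r true * Γ.gen r false) * Γ.gen q false * (Γ.gen s false * Γ.gen p false) ^ n := by
          simp only [mul_assoc]
    _ = Γ.gen p true ^ n * Γ.gen s true ^ n * (Γ.gen q true * Γ.gen q false) *
        (Γ.gen s false * Γ.gen p false) ^ n := by
          rw [gen_true_mul_gen_false, mul_one, hqs.eq]; simp only [mul_assoc]
    _ = Γ.gen s true ^ n * (Γ.gen p true ^ n * Γ.gen p false ^ n) * Γ.gen s false ^ n := by
          rw [gen_true_mul_gen_false, mul_one, hps.eq, hsp.eq, hsp.symm.mul_pow]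
          simp only [mul_assoc]
    _ = 1 := by simp only [gen_true_pow_mul_gen_false_pow, mul_one]

theorem queueValue_cons (hQ : Γ.IsQuad p q r s) (m : Move) (t : List Move) (n : ℕ) :
    Γ.queueValue p q r s m.2.1 (m :: t) n =
      Γ.gen p true ^ m.2.1 * Γ.gen q true * Γ.gen s true ^ m.2.1 * Γ.gen r true *
        Γ.queueValue p q r s m.2.2 t n := by
  have hpr : Commute (Γ.gen p true ^ m.2.2) (Γ.gen r true) :=
    (Γ.commute_gen hQ.adj_pr.2 _ _).pow_left _
  simp only [queueValue, moveValue, List.map_cons, List.prod_cons, mul_assoc]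
  rw [← mul_assoc (Γ.gen p true ^ m.2.2), hpr.eq, mul_assoc]

theorem exists_matcher_of_follows (hQ : Γ.IsQuad p q r s) {t : List Move} {c c' : NumConf}
    (h : Follows t c c') : ∃ w ∈ Γ.matcher p q r s, Γ.queueValue p q r s c.2 t c'.2 * w = 1 := by
  have last (n : ℕ) {w} (hw : w ∈ Γ.matcher p q r s) :
      w * (Γ.gen r false * Γ.gen q false * (Γ.gen s false * Γ.gen p false) ^ n) ∈
        Γ.matcher p q r s :=
    mul_mem hw <| mul_mem (Submonoid.subset_closure (.inr rfl)) <|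
      pow_mem (Submonoid.subset_closure (.inl rfl)) n
  induction t generalizing c with
  | nil =>
    obtain rfl : c = c' := h
    exact ⟨_, last c.2 (one_mem _), by simpa [queueValue] using hQ.block_mul_cancel c.2⟩
  | cons m t ih =>
    obtain ⟨hm, ht⟩ := h
    obtain ⟨w, hw, hw'⟩ := ih ht
    refine ⟨_, last c.2 hw, ?_⟩
    rw [hm, hQ.queueValue_cons, ← mul_assoc, mul_assoc _ _ w, hw', mul_one, hQ.block_mul_cancel]

theorem pairHom_queueValue_left (hQ : Γ.IsQuad p q r s) (hpq : ¬ Γ.Adj p q) (m n : ℕ)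
    (t : List Move) : Γ.pairHom hpq (Γ.queueValue p q r s m t n) =
      blockProd (m :: t.map fun e => e.2.2) := by
  have hr : Γ.pairHom hpq (Γ.gen r true) = 1 := by
    simp [pairHom_gen, pairGen, hQ.adj_pr.1.symm, hQ.ne_qr.symm]
  have hs : Γ.pairHom hpq (Γ.gen s true) = 1 := by
    simp [pairHom_gen, pairGen, hQ.adj_ps.1.symm, hQ.adj_qs.1.symm]
  have hp : Γ.pairHom hpq (Γ.gen p true) = .of true := by simp [pairHom_gen, pairGen]
  have hq : Γ.pairHom hpq (Γ.gen q true) = .of false := by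
    simp [pairHom_gen, pairGen, hQ.ne_pq.symm]
  simp [queueValue, moveValue, blockProd, map_list_prod, Function.comp_def, hp, hq, hr, hs]

theorem pairHom_queueValue_right (hQ : Γ.IsQuad p q r s) (hsr : ¬ Γ.Adj s r) (m n : ℕ)
    (t : List Move) : Γ.pairHom hsr (Γ.queueValue p q r s m t n) =
      blockProd (t.map (fun e => e.2.1) ++ [n]) := by
  have hp : Γ.pairHom hsr (Γ.gen p true) = 1 := by
    simp [pairHom_gen, pairGen, hQ.adj_pr.1, hQ.adj_ps.1]
  have hq : Γ.pairHom hsr (Γ.gen q true) = 1 := by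
    simp [pairHom_gen, pairGen, hQ.ne_qr, hQ.adj_qs.1]
  have hs : Γ.pairHom hsr (Γ.gen s true) = .of true := by simp [pairHom_gen, pairGen]
  have hr : Γ.pairHom hsr (Γ.gen r true) = .of false := by
    simp [pairHom_gen, pairGen, hQ.ne_sr.symm]
  simp [queueValue, moveValue, blockProd, map_list_prod, Function.comp_def, hp, hq, hr, hs,
    mul_assoc]

theorem pairHom_eq_of_mem_matcher (hQ : Γ.IsQuad p q r s) (hpq : ¬ Γ.Adj p q)
    (hsr : ¬ Γ.Adj s r) {w : Γ.GraphMonoid} (hw : w ∈ Γ.matcher p q r s) :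
    Γ.pairHom hpq w = Γ.pairHom hsr w := by
  refine MonoidHom.eqOn_closureM (?_ : Set.EqOn _ _ _) hw
  rintro _ (rfl | rfl) <;>
    simp [pairHom_gen, pairGen, hQ.adj_pr.1, hQ.adj_pr.1.symm, hQ.adj_ps.1, hQ.adj_ps.1.symm,
      hQ.adj_qs.1, hQ.adj_qs.1.symm, hQ.ne_pq.symm, hQ.ne_qr, hQ.ne_qr.symm, hQ.ne_sr.symm]

theorem follows_iff_exists_matcher (hQ : Γ.IsQuad p q r s) {t : List Move} {c c' : NumConf} :
    Follows t c c' ↔ c'.1 = c.1 ++ (t.map fun m => m.1).flatten ∧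
      ∃ w ∈ Γ.matcher p q r s, Γ.queueValue p q r s c.2 t c'.2 * w = 1 := by
  refine ⟨fun h => ⟨(follows_iff.1 h).1, hQ.exists_matcher_of_follows h⟩, fun ⟨hx, w, hw, h⟩ =>
    follows_iff.2 ⟨hx, blockProd_injective ?_⟩⟩
  have hpq : ¬ Γ.Adj p q := fun h => hQ.not_adj_pq ⟨hQ.ne_pq, h⟩
  have hsr : ¬ Γ.Adj s r := fun h => hQ.not_adj_sr ⟨hQ.ne_sr, h⟩
  have map_eq_inv (f : Γ.GraphMonoid →* FreeGroup Bool) :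
      f (Γ.queueValue p q r s c.2 t c'.2) = (f w)⁻¹ :=
    eq_inv_of_mul_eq_one_left (by rw [← map_mul, h, map_one])
  rw [← hQ.pairHom_queueValue_left hpq c.2 c'.2, ← hQ.pairHom_queueValue_right hsr c.2 c'.2,
    map_eq_inv, map_eq_inv, hQ.pairHom_eq_of_mem_matcher hpq hsr hw]

end IsQuad

end LoopGraph

namespace LoopGraph

variable {V : Type u} {Γ : LoopGraph V} {p q r s : V}

/-- The value of a sequence of moves: the input read and the storage content. -/
def traceValue (Γ : LoopGraph V) (p q r s : V) : FreeMonoid Move →* FreeMonoid ℕ × Γ.GraphMonoid :=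
  FreeMonoid.lift fun m => (FreeMonoid.ofList m.1, Γ.moveValue p q r s m)

theorem traceValue_apply (Γ : LoopGraph V) (p q r s : V) (t : FreeMonoid Move) :
    Γ.traceValue p q r s t = (FreeMonoid.ofList (t.toList.map fun m => m.1).flatten,
      (t.toList.map (Γ.moveValue p q r s)).prod) := by
  induction t using FreeMonoid.inductionOn' with
  | one => rfl
  | of_mul m t ih =>
    rw [map_mul, ih]
    simp [traceValue, FreeMonoid.ofList_append]

theorem moveValue_affine (hps : Γ.Adj p s) (y : List ℕ) (a b c d t : ℕ) :
    Γ.moveValue p q r s (y, a * t + b, c * t + d) = Γ.gen s true ^ b * Γ.gen p true ^ d *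
      (Γ.gen s true ^ a * Γ.gen p true ^ c) ^ t * (Γ.gen r true * Γ.gen q true) := by
  have h (m n : ℕ) : Commute (Γ.gen s true ^ m) (Γ.gen p true ^ n) :=
    (Γ.commute_gen hps _ _).symm.pow_pow m n
  rw [(h a c).mul_pow, ← pow_mul, ← pow_mul, ← mul_assoc, moveValue, mul_assoc (Γ.gen s true ^ b),
    ← mul_assoc (Γ.gen p true ^ d), ← (h (a * t) d).eq, add_comm (a * t),
    add_comm (c * t), pow_add, pow_add]
  simp only [mul_assoc]

theorem closure_image_labelValue (Γ : LoopGraph V) (p q r s : V) :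
    Submonoid.closure (Γ.labelValue ''
      {a | a ∈ [([], [(s, false), (p, false)]), ([], [(r, false), (q, false)])]}) =
      (Γ.matcher p q r s).map (MonoidHom.inr (FreeMonoid ℕ) _) := by
  rw [matcher, MonoidHom.map_mclosure, Set.image_pair]
  congr 1
  ext x
  simp [labelValue, wordClass_pair, eq_comm]

end LoopGraph

theorem primrec₂_nat_pow : Primrec₂ ((· ^ ·) : ℕ → ℕ → ℕ) :=
  Primrec₂.unpaired'.1 Nat.Primrec.pow

theorem primrec₂_list_replicate {α : Type*} [Primcodable α] :
    Primrec₂ (List.replicate : ℕ → α → List α) :=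
  Primrec.of_eq (f := fun p : ℕ × α => (List.range p.1).map fun _ => p.2)
    (Primrec.list_map (Primrec.list_range.comp Primrec.fst) (Primrec.snd.comp Primrec.fst).to₂)
    fun p => by simp

theorem primrec₂_replicate_append_replicate {α : Type*} [Primcodable α] (x y : α) :
    Primrec₂ fun m n : ℕ => List.replicate m x ++ List.replicate n y :=
  Primrec.list_append.comp (primrec₂_list_replicate.comp Primrec.fst (Primrec.const _))
    (primrec₂_list_replicate.comp Primrec.snd (Primrec.const _))

section Storage

open Pointwise

variable {V : Type u} [Primcodable V] {ι : Type v} [Primcodable ι]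

namespace AffineRealizable

open LoopGraph

variable {Γ : LoopGraph V} {p q r s : V}

theorem uniformlyRational_affine (hps : Γ.Adj p s) {a c : ι → ℕ}
    {σ : ι → List (List ℕ × ℕ × ℕ)} (ha : Primrec a) (hc : Primrec c) (hσ : Primrec σ) :
    UniformlyRational Γ.labelValue fun i => Γ.traceValue p q r s '' {x | ∃ e ∈ σ i, ∃ t,
      x = FreeMonoid.of (e.1, a i * t + e.2.1, c i * t + e.2.2)} := by
  have offset : Primrec fun i => (σ i).map fun e =>
      (e.1, List.replicate e.2.1 (s, true) ++ List.replicate e.2.2 (p, true)) :=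
    Primrec.list_map hσ (Primrec.pair (Primrec.fst.comp Primrec.snd)
      ((primrec₂_replicate_append_replicate _ _).comp (Primrec.fst.comp
        (Primrec.snd.comp Primrec.snd)) (Primrec.snd.comp (Primrec.snd.comp Primrec.snd)))).to₂
  have slope : Primrec fun i =>
      [(([] : List ℕ), List.replicate (a i) (s, true) ++ List.replicate (c i) (p, true))] :=
    Primrec.list_cons.comp (Primrec.pair (Primrec.const _)
      ((primrec₂_replicate_append_replicate _ _).comp ha hc)) (Primrec.const _)
  have value (e : List ℕ × ℕ × ℕ) (i t) :
      Γ.traceValue p q r s (.of (e.1, a i * t + e.2.1, c i * t + e.2.2)) =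
        Γ.labelValue (e.1, List.replicate e.2.1 (s, true) ++ List.replicate e.2.2 (p, true)) *
          Γ.labelValue ([], List.replicate (a i) (s, true) ++ List.replicate (c i) (p, true)) ^ t *
          Γ.labelValue ([], [(r, true), (q, true)]) := by
    simp [traceValue, labelValue, moveValue_affine hps, wordClass_append, wordClass_replicate,
      wordClass_pair]
  convert ((UniformlyRational.atom offset).mul (.star (.atom slope))).mul
    (.atom (Primrec.const [([], [(r, true), (q, true)])])) using 2 with i
  ext x
  simp only [Set.mem_image, Set.mem_mul, List.mem_singleton, Set.ofPred_eq_eq_singleton,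
    Set.image_singleton, SetLike.mem_coe, Submonoid.mem_closure_singleton, Set.mem_ofPred_eq,
    List.mem_map, Set.mem_singleton_iff, exists_eq_left, exists_exists_and_eq_and,
    exists_exists_eq_and]
  constructor
  · rintro ⟨_, ⟨e, he, t, rfl⟩, rfl⟩
    exact ⟨_, ⟨e, he, t, rfl⟩, (value e i t).symm⟩
  · rintro ⟨_, ⟨e, he, t, rfl⟩, rfl⟩
    exact ⟨_, ⟨e, he, t, rfl⟩, value e i t⟩

theorem exists_traces (hps : Γ.Adj p s) {R : ι → NumConf → NumConf → Prop}
    (hR : AffineRealizable R) :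
    ∃ T : ι → Set (FreeMonoid Move),
      UniformlyRational Γ.labelValue (fun i => Γ.traceValue p q r s '' T i) ∧
      ∀ i c c', R i c c' ↔ ∃ t ∈ T i, Follows t.toList c c' := by
  induction hR with
  | affine ha hc hσ =>
    refine ⟨_, uniformlyRational_affine hps ha hc hσ, fun i c c' => ?_⟩
    constructor
    · rintro ⟨e, he, t, h⟩
      exact ⟨_, ⟨e, he, t, rfl⟩, follows_singleton.2 h⟩
    · rintro ⟨_, ⟨e, he, t, rfl⟩, h⟩
      exact ⟨e, he, t, follows_singleton.1 h⟩
  | comp _ _ hR hS =>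
    obtain ⟨T, hT, hR⟩ := hR
    obtain ⟨U, hU, hS⟩ := hS
    refine ⟨fun i => T i * U i, by simpa only [Set.image_mul] using hT.mul hU, fun i c c' => ?_⟩
    simp only [Relation.Comp, hR, hS, Set.mem_mul]
    constructor
    · rintro ⟨d, ⟨t, ht, htd⟩, u, hu, hud⟩
      exact ⟨_, ⟨t, ht, u, hu, rfl⟩, follows_append.2 ⟨d, htd, hud⟩⟩
    · rintro ⟨_, ⟨t, ht, u, hu, rfl⟩, h⟩
      obtain ⟨d, htd, hud⟩ := follows_append.1 h
      exact ⟨d, ⟨t, ht, htd⟩, u, hu, hud⟩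
  | star _ hR =>
    obtain ⟨T, hT, hR⟩ := hR
    refine ⟨fun i => Submonoid.closure (T i), ?_, fun i _ _ => reflTransGen_iff_follows (hR i)⟩
    simpa only [← MonoidHom.map_mclosure, Submonoid.coe_map] using hT.star

theorem uniformlyRational_queue {T : ι → Set (FreeMonoid Move)}
    (hT : UniformlyRational Γ.labelValue fun i => Γ.traceValue p q r s '' T i) {n₀ : ι → ℕ}
    (hn₀ : Primrec n₀) :
    UniformlyRational Γ.labelValue fun i => {z | ∃ t ∈ T i, ∃ n, ∃ w ∈ Γ.matcher p q r s,
      (FreeMonoid.ofList (t.toList.map fun m => m.1).flatten,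
        Γ.queueValue p q r s (n₀ i) t.toList n * w) = z} := by
  have start : Primrec fun i => [(([] : List ℕ), List.replicate (n₀ i) (p, true) ++ [(q, true)])] :=
    Primrec.list_cons.comp (Primrec.pair (Primrec.const _) (Primrec.list_append.comp
      (primrec₂_list_replicate.comp hn₀ (Primrec.const _)) (Primrec.const _))) (Primrec.const _)
  have value (i) (t : FreeMonoid Move) (n : ℕ) (w : Γ.GraphMonoid) :
      Γ.labelValue ([], List.replicate (n₀ i) (p, true) ++ [(q, true)]) * Γ.traceValue p q r s t *
        Γ.labelValue ([], [(s, true)]) ^ n * Γ.labelValue ([], [(r, true)]) *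
        MonoidHom.inr (FreeMonoid ℕ) _ w =
      (.ofList (t.toList.map fun m => m.1).flatten,
        Γ.queueValue p q r s (n₀ i) t.toList n * w) := by
    simp [traceValue_apply, labelValue, wordClass_append, wordClass_replicate, queueValue, gen]
  convert ((((UniformlyRational.atom start).mul hT).mul
    (.star (.atom (Primrec.const [([], [(s, true)])])))).mul
    (.atom (Primrec.const [([], [(r, true)])]))).mul (.star (.atom (Primrec.const
      [([], [(s, false), (p, false)]), ([], [(r, false), (q, false)])]))) using 2 with i
  ext z
  simp only [Set.mem_image, Set.mem_mul, List.mem_singleton, Set.ofPred_eq_eq_singleton,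
    Set.image_singleton, SetLike.mem_coe, Submonoid.mem_closure_singleton, Set.mem_ofPred_eq,
    closure_image_labelValue, Submonoid.mem_map, Set.mem_singleton_iff, exists_eq_left,
    exists_exists_and_eq_and, exists_exists_eq_and, ← value]
  constructor
  · rintro ⟨t, ht, n, w, hw, h⟩
    exact ⟨_, ⟨t, ht, n, rfl⟩, w, hw, h⟩
  · rintro ⟨_, ⟨t, ht, n, rfl⟩, w, hw, h⟩
    exact ⟨t, ht, n, w, hw, h⟩

theorem exists_valenceCode (hQ : Γ.IsQuad p q r s) {R : ι → NumConf → NumConf → Prop}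
    (hR : AffineRealizable R) {n₀ : ι → ℕ} (hn₀ : Primrec n₀) :
    ∃ g : ι → ValenceCode V, Primrec g ∧ ∀ i k, ((g i).toAutomaton Γ k).language =
      {x : List (Fin k) | ∃ n, R i ([], n₀ i) (x.map Fin.val, n)} := by
  obtain ⟨T, hT, hR⟩ := hR.exists_traces (p := p) (q := q) (r := r) (s := s) hQ.adj_ps.2
  obtain ⟨g, hg, h⟩ := (uniformlyRational_queue hT hn₀).exists_valenceCode
  refine ⟨g, hg, fun i k => (h i k).trans (Set.ext fun x => ?_)⟩
  simp only [Set.mem_ofPred_eq, hR, hQ.follows_iff_exists_matcher, List.nil_append, Prod.mk.injEq]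
  constructor
  · rintro ⟨t, ht, n, w, hw, hx, h⟩
    exact ⟨n, t, ht, hx.symm, w, hw, h⟩
  · rintro ⟨n, t, ht, hx, w, hw, h⟩
    exact ⟨t, ht, n, w, hw, hx.symm, h⟩

end AffineRealizable

end Storage

/-! ### Machines with finitely many registers -/

section Registers

open Relation

variable {κ : Type} [Fintype κ]

/-- A configuration of a machine with registers named by `κ`: the input read so far and the
contents of the registers. -/
abbrev RegConf (κ : Type) : Type := List ℕ × (κ → ℕ)

/-- Gödel's encoding of register contents as a product of powers of distinct primes. -/
def primeCode (π : κ ↪ Nat.Primes) (x : κ → ℕ) : ℕ := ∏ i, (π i : ℕ) ^ x i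

theorem primeCode_add (π : κ ↪ Nat.Primes) (x y : κ → ℕ) :
    primeCode π (x + y) = primeCode π x * primeCode π y := by
  simp only [primeCode, Pi.add_apply, pow_add, Finset.prod_mul_distrib]

theorem primeCode_single [DecidableEq κ] (π : κ ↪ Nat.Primes) (i : κ) (n : ℕ) :
    primeCode π (Pi.single i n) = π i ^ n := by
  rw [primeCode, Finset.prod_eq_single i (fun j _ h => by simp [h]) (by simp), Pi.single_eq_same]

theorem primeCode_pos (π : κ ↪ Nat.Primes) (x : κ → ℕ) : 0 < primeCode π x :=
  Finset.prod_pos fun i _ => pow_pos (π i).2.pos _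

theorem factorization_primeCode (π : κ ↪ Nat.Primes) (x : κ → ℕ) (i : κ) :
    (primeCode π x).factorization (π i) = x i := by
  rw [primeCode, Nat.factorization_prod_apply fun j _ => pow_ne_zero _ (π j).2.ne_zero,
    Finset.sum_eq_single i _ (by simp)]
  · rw [(π i).2.factorization_pow, Finsupp.single_eq_same]
  · intro j _ hj
    rw [(π j).2.factorization_pow, Finsupp.single_eq_of_ne]
    exact fun h => hj (π.injective (Subtype.ext h.symm))

theorem primeCode_dvd_primeCode {π : κ ↪ Nat.Primes} {x y : κ → ℕ} :
    primeCode π x ∣ primeCode π y ↔ x ≤ y := by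
  refine ⟨fun h i => ?_, fun h => ?_⟩
  · rw [← factorization_primeCode π x, ← factorization_primeCode π y]
    exact (Nat.factorization_le_iff_dvd (primeCode_pos π x).ne' (primeCode_pos π y).ne').2 h _
  · rw [← add_tsub_cancel_of_le h, primeCode_add]
    exact dvd_mul_right _ _

theorem prime_dvd_primeCode {π : κ ↪ Nat.Primes} {x : κ → ℕ} {i : κ} :
    (π i : ℕ) ∣ primeCode π x ↔ x i ≠ 0 := by
  rw [(π i).2.dvd_iff_one_le_factorization (primeCode_pos π x).ne', factorization_primeCode,
    Nat.one_le_iff_ne_zero]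

/-- A family of relations between configurations, indexed by the size of the input alphabet, is
realizable if it is induced by an affine realizable one along every prime encoding. -/
def Realizable (A : ℕ → RegConf κ → RegConf κ → Prop) : Prop :=
  ∀ π : κ ↪ Nat.Primes, ∃ R : ℕ → NumConf → NumConf → Prop, AffineRealizable R ∧
    ∀ k d c', R k (d.1, primeCode π d.2) c' ↔ ∃ d', A k d d' ∧ c' = (d'.1, primeCode π d'.2)

namespace Realizable

variable {A B : ℕ → RegConf κ → RegConf κ → Prop}

theorem comp (hA : Realizable A) (hB : Realizable B) : Realizable fun k => Comp (A k) (B k) := by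
  intro π
  obtain ⟨R, hR, hRA⟩ := hA π
  obtain ⟨S, hS, hSB⟩ := hB π
  refine ⟨_, hR.comp hS, fun k d c' => ⟨?_, ?_⟩⟩
  · rintro ⟨c, hc, hc'⟩
    obtain ⟨e, he, rfl⟩ := (hRA k d c).1 hc
    obtain ⟨d', hd', rfl⟩ := (hSB k e c').1 hc'
    exact ⟨d', ⟨e, he, hd'⟩, rfl⟩
  · rintro ⟨d', ⟨e, he, hd'⟩, rfl⟩
    exact ⟨_, (hRA k d _).2 ⟨e, he, rfl⟩, (hSB k e _).2 ⟨d', hd', rfl⟩⟩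

theorem star (hA : Realizable A) : Realizable fun k => ReflTransGen (A k) := by
  intro π
  obtain ⟨R, hR, hRA⟩ := hA π
  refine ⟨_, hR.star, fun k d c' => ⟨fun h => ?_, ?_⟩⟩
  · induction h with
    | refl => exact ⟨d, .refl, rfl⟩
    | tail _ h ih =>
      obtain ⟨e, he, rfl⟩ := ih
      obtain ⟨d', hd', rfl⟩ := (hRA k e _).1 h
      exact ⟨d', he.tail hd', rfl⟩
  · rintro ⟨d', hd', rfl⟩
    exact hd'.lift (fun d : RegConf κ => (d.1, primeCode π d.2))
      fun e e' h => (hRA k e _).2 ⟨e', h, rfl⟩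

theorem rewrite (u w : κ → ℕ) :
    Realizable fun _ d d' => ∃ ρ, d.2 = ρ + u ∧ d' = (d.1, ρ + w) := by
  refine fun π => ⟨_, .affine (Primrec.const (primeCode π u)) (Primrec.const (primeCode π w))
    (Primrec.const [([], 0, 0)]), fun k d c' => ?_⟩
  simp only [List.mem_singleton, exists_eq_left, add_zero, List.append_nil]
  constructor
  · rintro ⟨t, ht, rfl⟩
    obtain ⟨ρ, hρ⟩ := exists_add_of_le (primeCode_dvd_primeCode.1 (Dvd.intro t ht.symm))
    rw [hρ, primeCode_add] at ht
    obtain rfl := Nat.eq_of_mul_eq_mul_left (primeCode_pos π u) ht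
    exact ⟨_, ⟨ρ, hρ.trans (add_comm _ _), rfl⟩, by rw [primeCode_add, mul_comm]⟩
  · rintro ⟨_, ⟨ρ, hρ, rfl⟩, rfl⟩
    exact ⟨primeCode π ρ, by rw [hρ, primeCode_add, mul_comm], by rw [primeCode_add, mul_comm]⟩

theorem star_rewrite {u w : κ → ℕ} (huw : u * w = 0) :
    Realizable fun _ d d' => ∃ (v : ℕ) (ρ : κ → ℕ), d.2 = ρ + v • u ∧ d' = (d.1, ρ + v • w) := by
  convert (rewrite u w).star using 4 with _ d d'
  constructor
  · rintro ⟨v, ρ, hd, rfl⟩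
    obtain ⟨y, x⟩ := d
    subst hd
    induction v generalizing ρ with
    | zero => simpa using .refl
    | succ v ih =>
      refine .head ⟨ρ + v • u, by rw [succ_nsmul, add_assoc], rfl⟩ ?_
      have := ih (ρ + w)
      rw [add_right_comm, add_assoc ρ w, ← succ_nsmul'] at this
      exact this
  · intro h
    induction h with
    | refl => exact ⟨0, d.2, by simp⟩
    | tail _ h ih =>
      obtain ⟨v, ρ, hd, rfl⟩ := ih
      obtain ⟨ρ', hρ, rfl⟩ := h
      have le_of_disjoint : u ≤ ρ := by
        intro i
        have hi : ρ i + v * w i = ρ' i + u i := congrFun hρ i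
        rcases mul_eq_zero.1 (congrFun huw i) with h | h <;> simp only [h] at hi ⊢ <;> omega
      obtain ⟨τ, rfl⟩ := exists_add_of_le le_of_disjoint
      obtain rfl : τ + v • w = ρ' := by
        rw [add_assoc, add_comm] at hρ
        exact add_right_cancel hρ
      exact ⟨v + 1, τ, by rw [hd, succ_nsmul', add_comm u, add_assoc],
        by rw [succ_nsmul, ← add_assoc]⟩

theorem reflTransGen_countDown {k a : ℕ} (ha : a < k) (P n : ℕ) (y : List ℕ) (c' : NumConf) :
    ReflTransGen (fun c c' : NumConf => ∃ b < k - 1, ∃ t, c.2 = k * t + (b + 1) ∧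
      c' = (c.1, k * P * t + b)) (y, k * n + a) c' ↔
      ∃ j b, j + b = a ∧ c' = (y, k * (P ^ j * n) + b) := by
  constructor
  · intro h
    induction h with
    | refl => exact ⟨0, a, zero_add a, by simp⟩
    | tail _ h ih =>
      obtain ⟨j, b, hjb, rfl⟩ := ih
      obtain ⟨b', hb', t, heq, rfl⟩ := h
      have hdiv := congrArg (· / k) heq
      have hmod := congrArg (· % k) heq
      simp only [Nat.mul_add_div (by omega : 0 < k), Nat.mul_add_mod,
        Nat.div_eq_of_lt (by omega : b < k), Nat.div_eq_of_lt (by omega : b' + 1 < k),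
        Nat.mod_eq_of_lt (by omega : b < k), Nat.mod_eq_of_lt (by omega : b' + 1 < k)] at hdiv hmod
      refine ⟨j + 1, b', by omega, ?_⟩
      rw [← add_zero t, ← hdiv, add_zero, pow_succ', mul_assoc P, mul_assoc k]
  · rintro ⟨j, b, rfl, rfl⟩
    induction j generalizing n with
    | zero => simpa using .refl
    | succ j ih =>
      refine .head ⟨j + b, by omega, n, by omega, rfl⟩ ?_
      have := ih (P * n) (by omega)
      rwa [← mul_assoc k, ← mul_assoc (P ^ j), ← pow_succ] at this

/-- The letter `a < k` is first stored as the lowest digit to the base `k`. Then it is counted down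
while the number formed by the other digits is multiplied by the prime of the register. -/
theorem read [DecidableEq κ] (i : κ) :
    Realizable fun k d d' => ∃ a < k, d' = (d.1 ++ [a], d.2 + Pi.single i a) := by
  intro π
  refine ⟨_, .comp (.comp
    (.affine (Primrec.const 1) .id (σ := fun k => (List.range k).map fun a => ([a], 0, a)) ?_)
    (.star (.affine .id (Primrec.nat_mul.comp .id (Primrec.const (π i : ℕ)))
      (σ := fun k => (List.range (k - 1)).map fun b => ([], b + 1, b)) ?_)))
    (.affine .id (Primrec.const 1) (Primrec.const [([], 0, 0)])), fun k d c' => ?_⟩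
  · exact .list_map .list_range <| Primrec.pair
      (Primrec.list_cons.comp .snd (.const [])) (.pair (.const 0) .snd)
  · exact .list_map (.comp .list_range (Primrec.nat_sub.comp .id (.const 1))) <| Primrec.pair
      (.const []) (.pair (Primrec.succ.comp .snd) .snd)
  simp only [List.mem_map, List.mem_range, exists_exists_and_eq_and, List.append_nil, one_mul,
    add_zero, id, List.mem_singleton, exists_eq_left, Comp]
  constructor
  · rintro ⟨_, ⟨_, ⟨a, ha, _, rfl, rfl⟩, hc⟩, t, ht, rfl⟩
    obtain ⟨j, b, rfl, rfl⟩ := (reflTransGen_countDown ha _ _ _ _).1 hc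
    obtain ⟨rfl, rfl⟩ : b = 0 ∧ (π i) ^ j * primeCode π d.2 = t := by
      have hb : b = 0 := by
        have := congrArg (· % k) ht
        simpa [Nat.mod_eq_of_lt (by omega : b < k)] using this
      subst hb
      exact ⟨rfl, Nat.eq_of_mul_eq_mul_left (by omega) ht⟩
    exact ⟨_, ⟨j, ha, rfl⟩, by simp only [primeCode_add, primeCode_single, mul_comm, add_zero]⟩
  · rintro ⟨_, ⟨a, ha, rfl⟩, rfl⟩
    exact ⟨_, ⟨_, ⟨a, ha, _, rfl, rfl⟩,
      (reflTransGen_countDown ha _ _ _ _).2 ⟨a, 0, add_zero a, rfl⟩⟩, _, rfl,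
      by rw [primeCode_add, primeCode_single, mul_comm]⟩

end Realizable

theorem eq_of_elim_eq {κ : Type} {m : ℕ} {d d' : RegConf κ} {v v' : Fin m → ℕ}
    (h : (d'.1, Sum.elim d'.2 v') = (d.1, Sum.elim d.2 v)) : d' = d :=
  Prod.ext (congrArg Prod.fst h :)
    (congrArg (fun e : RegConf (κ ⊕ Fin m) => e.2 ∘ Sum.inl) h)

theorem exists_primes_extension {κ : Type*} [Finite κ] (π : κ ↪ Nat.Primes) (m : ℕ) :
    ∃ π' : κ ⊕ Fin m ↪ Nat.Primes, ∀ i, π' (.inl i) = π i := by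
  obtain ⟨ψ, hψ⟩ := Fin.Embedding.exists_embedding_disjoint_range_of_add_le_ENat_card
    (α := Nat.Primes) (s := Set.range π) (n := m) (by simp)
  refine ⟨⟨Sum.elim π ψ, π.injective.sumElim ψ.injective fun i j h => ?_⟩, fun _ => rfl⟩
  exact Set.disjoint_left.1 hψ ⟨i, rfl⟩ ⟨j, h.symm⟩

namespace Realizable

theorem of_eq {A B : ℕ → RegConf κ → RegConf κ → Prop} (hA : Realizable A)
    (h : ∀ k d d', A k d d' ↔ B k d d') : Realizable B := by
  obtain rfl : A = B := funext₃ fun k d d' => propext (h k d d')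
  exact hA

/-- Local registers hold `0` before and after, so that the primes assigned to them do not occur in
the encoding. -/
theorem restrict {m : ℕ} {A : ℕ → RegConf (κ ⊕ Fin m) → RegConf (κ ⊕ Fin m) → Prop}
    (hA : Realizable A) (hzero : ∀ k d d', A k d d' → d'.2 ∘ Sum.inr = 0) :
    Realizable fun k d d' => A k (d.1, Sum.elim d.2 0) (d'.1, Sum.elim d'.2 0) := by
  intro π
  obtain ⟨π', hπ'⟩ := exists_primes_extension π m
  have code_elim (x : κ → ℕ) : primeCode π' (Sum.elim x 0) = primeCode π x := by
    simp only [primeCode, Fintype.prod_sum_type, Sum.elim_inl, Sum.elim_inr, hπ', Pi.zero_apply,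
      pow_zero, Finset.prod_const_one, mul_one]
  obtain ⟨R, hR, hRA⟩ := hA π'
  refine ⟨R, hR, fun k d c' => ?_⟩
  rw [← code_elim, hRA k (d.1, Sum.elim d.2 0)]
  constructor
  · rintro ⟨⟨y, x⟩, hd', rfl⟩
    obtain ⟨x, rfl⟩ : ∃ x₀ : κ → ℕ, x = Sum.elim x₀ 0 :=
      ⟨x ∘ Sum.inl, by rw [← hzero _ _ _ hd', Sum.elim_comp_inl_inr]⟩
    exact ⟨(y, x), hd', by rw [code_elim]⟩
  · rintro ⟨d', hd', rfl⟩
    exact ⟨_, hd', by rw [code_elim]⟩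

end Realizable

/-- A property of register contents is testable if the corresponding partial identity relation is
realizable. -/
def Testable (φ : (κ → ℕ) → Prop) : Prop :=
  Realizable fun _ (d d' : RegConf κ) => d' = d ∧ φ d.2

namespace Testable

theorem of_iff {φ ψ : (κ → ℕ) → Prop} (hφ : Testable φ) (h : ∀ x, φ x ↔ ψ x) : Testable ψ :=
  Realizable.of_eq hφ fun _ d _ => and_congr_right fun _ => h d.2

theorem zero (i : κ) : Testable fun x => x i = 0 := by
  intro π
  refine ⟨_, .affine (Primrec.const (π i : ℕ)) (Primrec.const (π i : ℕ))
    (Primrec.const ((List.range (π i - 1)).map fun r => ([], r + 1, r + 1))), fun k d c' => ?_⟩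
  simp only [List.mem_map, List.mem_range, exists_exists_and_eq_and, List.append_nil]
  have hpos := (π i).2.two_le
  constructor
  · rintro ⟨r, hr, t, ht, rfl⟩
    refine ⟨d, ⟨rfl, not_not.1 fun h => ?_⟩, by rw [ht]⟩
    have := (Nat.dvd_add_right (Dvd.intro _ rfl)).1 (ht ▸ prime_dvd_primeCode.2 h)
    exact absurd (Nat.le_of_dvd r.succ_pos this) (by omega)
  · rintro ⟨d, ⟨rfl, h⟩, rfl⟩
    have hmod : primeCode π d.2 % π i ≠ 0 := fun h' =>
      prime_dvd_primeCode.1 (Nat.dvd_of_mod_eq_zero h') h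
    have hlt := Nat.mod_lt (primeCode π d.2) (π i).2.pos
    have hdiv := Nat.div_add_mod (primeCode π d.2) (π i)
    refine ⟨primeCode π d.2 % π i - 1, by omega, primeCode π d.2 / π i, ?_⟩
    rw [Nat.sub_add_cancel (by omega), hdiv]
    exact ⟨rfl, rfl⟩

theorem trivial : Testable fun _ : κ → ℕ => True :=
  (Realizable.rewrite 0 0).of_eq fun _ d d' => by simp

theorem and {φ ψ : (κ → ℕ) → Prop} (hφ : Testable φ) (hψ : Testable ψ) :
    Testable fun x => φ x ∧ ψ x :=
  (Realizable.comp hφ hψ).of_eq fun _ d d' => by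
    constructor
    · rintro ⟨_, ⟨rfl, h⟩, rfl, h'⟩
      exact ⟨rfl, h, h'⟩
    · rintro ⟨rfl, h, h'⟩
      exact ⟨d', ⟨rfl, h⟩, rfl, h'⟩

theorem forall_mem {α : Type*} (s : Finset α) {φ : α → (κ → ℕ) → Prop}
    (hφ : ∀ a ∈ s, Testable (φ a)) : Testable fun x => ∀ a ∈ s, φ a x := by
  classical
  induction s using Finset.induction with
  | empty => simpa using trivial
  | insert a s _ ih =>
    simp only [Finset.forall_mem_insert] at hφ ⊢
    exact hφ.1.and (ih hφ.2)

end Testable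

namespace Realizable

theorem add (w : κ → ℕ) : Realizable fun _ d d' => d' = (d.1, d.2 + w) :=
  (rewrite 0 w).of_eq fun _ _ _ =>
    ⟨fun ⟨_, hρ, h⟩ => h.trans (Prod.ext rfl (congrArg (· + w) hρ.symm)), fun h => ⟨_, rfl, h⟩⟩

theorem havoc [DecidableEq κ] (i : κ) : Realizable fun _ d d' =>
    ∃ v, d' = (d.1, Function.update d.2 i v) := by
  refine ((star_rewrite (mul_zero (Pi.single i 1))).comp <|
    star_rewrite (zero_mul (Pi.single i 1))).of_eq fun _ d d' => ?_
  simp only [Comp, smul_zero, add_zero]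
  constructor
  · rintro ⟨_, ⟨v, ρ, hd, rfl⟩, w, _, rfl, rfl⟩
    refine ⟨ρ i + w, Prod.ext rfl (funext fun j => ?_)⟩
    obtain rfl | hj := eq_or_ne j i <;> simp_all
  · rintro ⟨v, rfl⟩
    refine ⟨(d.1, Function.update d.2 i 0), ⟨d.2 i, _, funext fun j => ?_, rfl⟩, v, _, rfl,
      Prod.ext rfl (funext fun j => ?_)⟩ <;> obtain rfl | hj := eq_or_ne j i <;> simp_all

theorem havoc_finset (s : Finset κ) : Realizable fun _ d d' =>
    ∃ y : κ → ℕ, (∀ i ∉ s, y i = d.2 i) ∧ d' = (d.1, y) := by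
  classical
  induction s using Finset.induction with
  | empty => exact (rewrite 0 0).of_eq fun _ d d' => by simp [← funext_iff]
  | insert a s ha ih =>
    refine ((havoc a).comp ih).of_eq fun _ d d' => ⟨?_, ?_⟩
    · rintro ⟨_, ⟨v, rfl⟩, y, hy, rfl⟩
      refine ⟨y, fun i hi => ?_, rfl⟩
      rw [Finset.mem_insert, not_or] at hi
      exact (hy i hi.2).trans (Function.update_of_ne hi.1 ..)
    · rintro ⟨y, hy, rfl⟩
      refine ⟨_, ⟨y a, rfl⟩, y, fun i hi => ?_, rfl⟩
      obtain rfl | hia := eq_or_ne i a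
      · exact (Function.update_self i _ d.2).symm
      · exact (hy i (by simp [hi, hia])).trans (Function.update_of_ne hia ..).symm

theorem havoc_inr (m : ℕ) : Realizable fun _ (d d' : RegConf (κ ⊕ Fin m)) =>
    ∃ v, d' = (d.1, Sum.elim (d.2 ∘ Sum.inl) v) := by
  classical
  refine (havoc_finset (κ := κ ⊕ Fin m) (Finset.univ.map Function.Embedding.inr)).of_eq
    fun _ d d' => ⟨?_, ?_⟩
  · rintro ⟨y, hy, rfl⟩
    have inl_eq : y ∘ Sum.inl = d.2 ∘ Sum.inl := funext fun i => hy (.inl i) (by simp)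
    exact ⟨y ∘ Sum.inr, by rw [← inl_eq, Sum.elim_comp_inl_inr]⟩
  · rintro ⟨v, rfl⟩
    exact ⟨_, fun i hi => by cases i <;> simp_all, rfl⟩

theorem hide {m : ℕ} {A : ℕ → RegConf (κ ⊕ Fin m) → RegConf (κ ⊕ Fin m) → Prop}
    (hA : Realizable A) :
    Realizable fun k d d' => ∃ v v', A k (d.1, Sum.elim d.2 v) (d'.1, Sum.elim d'.2 v') := by
  have clear : Testable fun x : κ ⊕ Fin m → ℕ => ∀ j ∈ Finset.univ, x (.inr j) = 0 :=
    .forall_mem _ fun j _ => .zero _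
  refine ((((havoc_inr m).comp hA).comp ((havoc_inr m).comp clear)).restrict ?_).of_eq
    fun k d d' => ⟨?_, ?_⟩
  · rintro k _ _ ⟨_, _, _, _, rfl, h⟩
    exact funext fun j => h j (Finset.mem_univ j)
  · rintro ⟨c, ⟨_, ⟨v, rfl⟩, hc⟩, _, ⟨w, rfl⟩, h, -⟩
    obtain ⟨y, x⟩ := c
    refine ⟨v, x ∘ Sum.inr, ?_⟩
    obtain rfl : d' = (y, x ∘ Sum.inl) := eq_of_elim_eq h
    rwa [Sum.elim_comp_inl_inr]
  · rintro ⟨v, v', h⟩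
    exact ⟨_, ⟨_, ⟨v, rfl⟩, h⟩, _, ⟨0, rfl⟩, rfl, fun j _ => rfl⟩

end Realizable

namespace Testable

theorem exists_fin {m : ℕ} {φ : (κ → ℕ) → (Fin m → ℕ) → Prop}
    (hφ : Testable fun y : κ ⊕ Fin m → ℕ => φ (y ∘ Sum.inl) (y ∘ Sum.inr)) :
    Testable fun x => ∃ v, φ x v :=
  (Realizable.hide hφ).of_eq fun _ d d' => by
    constructor
    · rintro ⟨v, v', h, hv⟩
      exact ⟨eq_of_elim_eq h, v, hv⟩
    · rintro ⟨rfl, v, hv⟩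
      exact ⟨v, v, rfl, hv⟩

theorem shift {φ : (κ → ℕ) → Prop} (hφ : Testable φ) (u : κ → ℕ) :
    Testable fun x => ∃ ρ, x = ρ + u ∧ φ ρ :=
  (((Realizable.rewrite u 0).comp hφ).comp (.add u)).of_eq fun _ d d' => by
    constructor
    · rintro ⟨_, ⟨_, ⟨ρ, hd, rfl⟩, rfl, hρ⟩, rfl⟩
      exact ⟨Prod.ext rfl hd.symm, ρ, hd, hρ⟩
    · rintro ⟨rfl, ρ, hd, hρ⟩
      exact ⟨_, ⟨_, ⟨ρ, hd, rfl⟩, rfl, hρ⟩, Prod.ext rfl hd⟩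

/-- The number `v` is kept in a local register. -/
theorem multishift {φ : (κ → ℕ) → Prop}
    (hφ : Testable fun y : κ ⊕ Fin 1 → ℕ => φ (y ∘ Sum.inl)) (u : κ → ℕ) :
    Testable fun x => ∃ (v : ℕ) (ρ : κ → ℕ), x = ρ + v • u ∧ φ ρ := by
  set u' : κ ⊕ Fin 1 → ℕ := Sum.elim u 0
  set c : κ ⊕ Fin 1 → ℕ := Sum.elim 0 1
  have disjoint : u' * c = 0 := funext fun i => by cases i <;> simp [u', c]
  have := ((Realizable.comp (Testable.zero (.inr 0)) (.star_rewrite disjoint)).comp hφ).comp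
    (.comp (.star_rewrite ((mul_comm _ _).trans disjoint)) (Testable.zero (.inr 0)))
  have inl_add (ρ : κ ⊕ Fin 1 → ℕ) (v : ℕ) : (ρ + v • c) ∘ Sum.inl = ρ ∘ Sum.inl :=
    funext fun i => by simp [c]
  refine this.hide.of_eq fun _ d d' => ⟨?_, ?_⟩
  · rintro ⟨p, p', _, ⟨_, ⟨_, ⟨rfl, hp⟩, v, ρ, hd, rfl⟩, rfl, hρ⟩, _, ⟨w, τ, hτ, rfl⟩, h, hp'⟩
    have hρ₀ : ρ (.inr 0) = 0 := by
      simpa [u', show p 0 = 0 from hp] using (congrFun hd (.inr 0)).symm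
    have hτ₀ : τ (.inr 0) = 0 := by simpa [u'] using hp'
    obtain rfl : v = w := by simpa [c, hρ₀, hτ₀] using congrFun hτ (.inr 0)
    obtain rfl := add_right_cancel hτ
    exact ⟨eq_of_elim_eq (h.trans (Prod.ext rfl hd.symm)), v, ρ ∘ Sum.inl,
      congrArg (· ∘ Sum.inl) hd, by simpa only [inl_add] using hρ⟩
  · rintro ⟨rfl, v, ρ, hd, hρ⟩
    have hd' : Sum.elim d'.2 (0 : Fin 1 → ℕ) = Sum.elim ρ 0 + v • u' := by
      funext i; cases i <;> simp [u', hd]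
    have hρ' : φ ((Sum.elim ρ (0 : Fin 1 → ℕ) + v • c) ∘ Sum.inl) := by rwa [inl_add]
    exact ⟨0, 0, _, ⟨_, ⟨_, ⟨rfl, rfl⟩, v, _, hd', rfl⟩, rfl, hρ'⟩, _, ⟨v, _, rfl, rfl⟩,
      Prod.ext rfl hd', by simp [u']⟩

theorem eq_of_ne {i j : κ} (hij : i ≠ j) : Testable fun x => x i = x j := by
  classical
  refine (multishift (φ := fun x => x i = 0 ∧ x j = 0) ((zero (Sum.inl i)).and (zero (Sum.inl j)))
    (Pi.single i 1 + Pi.single j 1)).of_iff fun x => ⟨?_, fun h => ?_⟩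
  · rintro ⟨v, ρ, rfl, hi, hj⟩
    simp [hi, hj, hij, hij.symm]
  · refine ⟨x i, Function.update (Function.update x i 0) j 0, funext fun l => ?_, by simp [hij]⟩
    obtain rfl | hj := eq_or_ne l j
    · simp [h, hij]
    obtain rfl | hi := eq_or_ne l i <;> simp [*]

theorem eq (i j : κ) : Testable fun x => x i = x j := by
  obtain rfl | hij := eq_or_ne i j
  · simpa using trivial
  · exact eq_of_ne hij

theorem succ_of_ne {i j : κ} (hij : i ≠ j) : Testable fun x => x i = x j + 1 := by
  classical
  refine ((eq i j).shift (Pi.single i 1)).of_iff fun x => ⟨?_, fun h => ?_⟩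
  · rintro ⟨ρ, rfl, h⟩
    simp [h, hij.symm]
  · refine ⟨Function.update x i (x j), funext fun l => ?_, by simp [hij.symm]⟩
    obtain rfl | hi := eq_or_ne l i <;> simp [*]

theorem succ (i j : κ) : Testable fun x => x i = x j + 1 := by
  have : Testable fun x : κ → ℕ => ∃ v : Fin 1 → ℕ, v 0 = x i ∧ v 0 = x j + 1 :=
    .exists_fin ((eq (.inr 0) (.inl i)).and (succ_of_ne Sum.inr_ne_inl))
  exact this.of_iff fun x => ⟨fun ⟨_, hi, hj⟩ => hi ▸ hj, fun h => ⟨fun _ => x i, rfl, h⟩⟩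

end Testable

namespace Realizable

theorem assign [DecidableEq κ] (i : κ) {φ : (κ → ℕ) → ℕ → Prop}
    (hφ : Testable fun y : κ ⊕ Fin 1 → ℕ => φ (y ∘ Sum.inl) (y (.inr 0))) :
    Realizable fun _ d d' => ∃ v, φ d.2 v ∧ d' = (d.1, Function.update d.2 i v) := by
  have := (hφ.comp (havoc (.inl i))).comp (Testable.eq (.inl i) (.inr 0))
  refine this.hide.of_eq fun _ d d' => ⟨?_, ?_⟩
  · rintro ⟨v, v', _, ⟨_, ⟨rfl, h⟩, w, rfl⟩, h', hw⟩
    obtain rfl : v 0 = w := by simpa using hw.symm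
    change _ = (d.1, Function.update (Sum.elim d.2 v) (.inl i) (v 0)) at h'
    rw [Sum.update_elim_inl] at h'
    exact ⟨v 0, h, eq_of_elim_eq h'⟩
  · rintro ⟨v, h, rfl⟩
    refine ⟨fun _ => v, fun _ => v, _, ⟨_, ⟨rfl, h⟩, v, rfl⟩, ?_, by simp⟩
    rw [Sum.update_elim_inl]

end Realizable

namespace Testable

/-- One iteration of a loop: the first local register counts the iterations, the second one holds
the current value. -/
def LoopStep (T : (κ → ℕ) → ℕ → ℕ → ℕ → Prop) (d d' : RegConf (κ ⊕ Fin 2)) : Prop :=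
  ∃ v, T (d.2 ∘ Sum.inl) (d.2 (.inr 0)) (d.2 (.inr 1)) v ∧
    d' = (d.1, Sum.elim (d.2 ∘ Sum.inl) ![d.2 (.inr 0) + 1, v])

theorem reflTransGen_loopStep {κ : Type} {T : (κ → ℕ) → ℕ → ℕ → ℕ → Prop} {y : List ℕ}
    {x : κ → ℕ} {a : ℕ} {d : RegConf (κ ⊕ Fin 2)} :
    ReflTransGen (LoopStep T) (y, Sum.elim x ![0, a]) d ↔ ∃ (s : ℕ → ℕ) (m : ℕ), s 0 = a ∧
      (∀ n < m, T x n (s n) (s (n + 1))) ∧ d = (y, Sum.elim x ![m, s m]) := by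
  constructor
  · intro h
    induction h with
    | refl => exact ⟨fun _ => a, 0, rfl, by simp, rfl⟩
    | tail _ h ih =>
      obtain ⟨s, m, hs, hT, rfl⟩ := ih
      obtain ⟨v, hv, rfl⟩ := h
      refine ⟨Function.update s (m + 1) v, m + 1, by simpa using hs, fun n hn => ?_, by simp⟩
      rw [Function.update_of_ne hn.ne]
      obtain hn | rfl := Nat.lt_succ_iff_lt_or_eq.1 hn
      · rw [Function.update_of_ne (by omega)]
        exact hT n hn
      · rw [Function.update_self]
        exact hv
  · rintro ⟨s, m, rfl, hT, rfl⟩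
    induction m with
    | zero => exact .refl
    | succ m ih => exact (ih fun n hn => hT n (by omega)).tail ⟨s (m + 1), hT m (by omega), rfl⟩

theorem realizable_loopStep {T : (κ → ℕ) → ℕ → ℕ → ℕ → Prop}
    (hT : Testable fun y : (κ ⊕ Fin 2) ⊕ Fin 1 → ℕ =>
      T (y ∘ Sum.inl ∘ Sum.inl) (y (.inl (.inr 0))) (y (.inl (.inr 1))) (y (.inr 0))) :
    Realizable fun _ => LoopStep T := by
  classical
  refine ((Realizable.assign (.inr 1) (φ := fun x => T (x ∘ Sum.inl) (x (.inr 0)) (x (.inr 1)))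
    hT).comp (.add (Pi.single (.inr 0) 1))).of_eq fun _ d d' => ?_
  have update_add (v : ℕ) : Function.update d.2 (.inr 1) v + Pi.single (.inr 0) 1 =
      Sum.elim (d.2 ∘ Sum.inl) ![d.2 (.inr 0) + 1, v] := by
    funext i
    rcases i with i | i
    · simp
    · fin_cases i <;> simp
  constructor
  · rintro ⟨_, ⟨v, hv, rfl⟩, rfl⟩
    exact ⟨v, hv, Prod.ext rfl (update_add v)⟩
  · rintro ⟨v, hv, rfl⟩
    exact ⟨_, ⟨v, hv, rfl⟩, Prod.ext rfl (update_add v).symm⟩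

theorem loop {T : (κ → ℕ) → ℕ → ℕ → ℕ → Prop}
    (hT : Testable fun y : (κ ⊕ Fin 2) ⊕ Fin 1 → ℕ =>
      T (y ∘ Sum.inl ∘ Sum.inl) (y (.inl (.inr 0))) (y (.inl (.inr 1))) (y (.inr 0)))
    (i j l : κ) :
    Testable fun x => ∃ s : ℕ → ℕ, s 0 = x i ∧ (∀ n < x j, T x n (s n) (s (n + 1))) ∧
      s (x j) = x l := by
  have init := (Testable.zero (.inr 0 : κ ⊕ Fin 2)).and (.eq (.inr 1) (.inl i))
  have final := (Testable.eq (.inr 0 : κ ⊕ Fin 2) (.inl j)).and (.eq (.inr 1) (.inl l))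
  refine ((Realizable.comp init (realizable_loopStep hT).star).comp final).hide.of_eq
    fun _ d d' => ⟨?_, ?_⟩
  · rintro ⟨v, v', _, ⟨_, ⟨rfl, h₀, h₁⟩, h⟩, h', hj, hl⟩
    obtain rfl : v = ![0, d.2 i] := by
      funext k
      fin_cases k
      exacts [h₀, h₁]
    obtain ⟨s, m, hs, hT, rfl⟩ := reflTransGen_loopStep.1 h
    obtain rfl : m = d.2 j := hj
    exact ⟨eq_of_elim_eq h', s, hs, hT, hl⟩
  · rintro ⟨rfl, s, hs, hT, hl⟩
    exact ⟨![0, d'.2 i], ![d'.2 j, d'.2 l], _, ⟨_, ⟨rfl, rfl, rfl⟩,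
      reflTransGen_loopStep.2 ⟨s, d'.2 j, hs, hT, rfl⟩⟩, by rw [hl], rfl, hl⟩

theorem forall_lt {T : (κ → ℕ) → ℕ → Prop}
    (hT : Testable fun y : (κ ⊕ Fin 2) ⊕ Fin 1 → ℕ => T (y ∘ Sum.inl ∘ Sum.inl) (y (.inl (.inr 0))))
    (j : κ) : Testable fun x => ∀ n < x j, T x n :=
  (Testable.loop (T := fun x n _ _ => T x n) hT j j j).of_iff fun x =>
    ⟨fun ⟨_, _, h, _⟩ => h, fun h => ⟨fun _ => x j, rfl, h, rfl⟩⟩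

end Testable

end Registers

section PartialRecursive

theorem mem_mOfFn_iff {α : Type u} {n : ℕ} {f : Fin n → Part α} {v : List.Vector α n} :
    v ∈ List.Vector.mOfFn f ↔ ∀ i, v.get i ∈ f i := by
  induction n with
  | zero => simp [List.Vector.mOfFn, Part.pure_eq_some, Subsingleton.elim v List.Vector.nil]
  | succ n ih =>
    simp only [List.Vector.mOfFn, Part.bind_eq_bind, Part.mem_bind_iff, ih, Part.pure_eq_some,
      Part.mem_some_iff, Fin.forall_fin_succ]
    constructor
    · rintro ⟨a, ha, w, hw, rfl⟩
      simpa using ⟨ha, hw⟩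
    · rintro ⟨ha, hw⟩
      exact ⟨_, ha, v.tail, fun i => by simpa using hw i, by simp⟩

/-- The graph of `f`, with the arguments and the value in arbitrary registers, can be tested. -/
def GraphTestable {n : ℕ} (f : List.Vector ℕ n → Part ℕ) : Prop :=
  ∀ (κ : Type) [Fintype κ] (o : κ) (i : Fin n → κ),
    Testable fun x : κ → ℕ => x o ∈ f (List.Vector.ofFn (x ∘ i))

namespace GraphTestable

theorem comp {m n : ℕ} {f : List.Vector ℕ n → Part ℕ} {g : Fin n → List.Vector ℕ m → Part ℕ}
    (hf : GraphTestable f) (hg : ∀ i, GraphTestable (g i)) :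
    GraphTestable fun a => (List.Vector.mOfFn fun i => g i a).bind f := by
  intro κ _ o i
  have args := Testable.forall_mem (Finset.univ : Finset (Fin n)) fun j _ =>
    hg j (κ ⊕ Fin n) (.inr j) (.inl ∘ i)
  refine (Testable.exists_fin (φ := fun x v => (∀ j, v j ∈ g j (List.Vector.ofFn (x ∘ i))) ∧
    x o ∈ f (List.Vector.ofFn v))
    ((args.and (hf (κ ⊕ Fin n) (.inl o) .inr)).of_iff fun y => ?_)).of_iff fun x => ?_
  · simp only [Finset.mem_univ, true_imp_iff]
    rfl
  · simp only [Part.mem_bind_iff, mem_mOfFn_iff]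
    constructor
    · rintro ⟨v, hv, ho⟩
      exact ⟨_, by simpa using hv, ho⟩
    · rintro ⟨v, hv, ho⟩
      exact ⟨v.get, hv, by simpa using ho⟩

theorem exists_iterate_iff_eq_rec {b c m : ℕ} (h : ℕ → ℕ → ℕ) :
    (∃ s : ℕ → ℕ, s 0 = b ∧ (∀ n < m, s (n + 1) = h n (s n)) ∧ s m = c) ↔ c = m.rec b h := by
  constructor
  · rintro ⟨s, rfl, hs, rfl⟩
    induction m with
    | zero => rfl
    | succ m ih => rw [hs m m.lt_succ_self, ih fun n hn => hs n (hn.trans m.lt_succ_self)]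
  · rintro rfl
    exact ⟨fun m => m.rec b h, rfl, fun _ _ => rfl, rfl⟩

theorem prec {n : ℕ} {f : List.Vector ℕ n → ℕ} {g : List.Vector ℕ (n + 2) → ℕ}
    (hf : GraphTestable fun v => Part.some (f v)) (hg : GraphTestable fun v => Part.some (g v)) :
    GraphTestable fun v : List.Vector ℕ (n + 1) => Part.some
      (v.head.rec (f v.tail) fun y a => g (y ::ᵥ a ::ᵥ v.tail)) := by
  intro κ _ o i
  have base := hf (κ ⊕ Fin 1) (.inr 0) (.inl ∘ i ∘ Fin.succ)
  have step := Testable.loop (κ := κ ⊕ Fin 1)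
    (T := fun x j a a' =>
      a' ∈ Part.some (g (j ::ᵥ a ::ᵥ List.Vector.ofFn (x ∘ .inl ∘ i ∘ Fin.succ))))
    (hg _ (Sum.inr 0) (Fin.cons (.inl (.inr 0)) (Fin.cons (.inl (.inr 1))
      (Sum.inl ∘ Sum.inl ∘ Sum.inl ∘ i ∘ Fin.succ)))) (.inr 0) (.inl (i 0)) (.inl o)
  refine (Testable.exists_fin (m := 1) (φ := fun x b =>
    b 0 = f (List.Vector.ofFn (x ∘ i ∘ Fin.succ)) ∧ ∃ s : ℕ → ℕ, s 0 = b 0 ∧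
      (∀ n < x (i 0), s (n + 1) = g (n ::ᵥ s n ::ᵥ List.Vector.ofFn (x ∘ i ∘ Fin.succ))) ∧
      s (x (i 0)) = x o) ((base.and step).of_iff fun y => ?_)).of_iff fun x => ?_
  · simp only [Part.mem_some_iff]
    rfl
  · rw [Part.mem_some_iff]
    have loop_iff (b : ℕ) := exists_iterate_iff_eq_rec (b := b) (c := x o) (m := x (i 0))
      fun j a => g (j ::ᵥ a ::ᵥ List.Vector.ofFn (x ∘ i ∘ Fin.succ))
    exact ⟨fun ⟨_, hb, ho⟩ => (loop_iff _).1 (hb ▸ ho),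
      fun ho => ⟨fun _ => _, rfl, (loop_iff _).2 ho⟩⟩

theorem of_primrec' {n : ℕ} {f : List.Vector ℕ n → ℕ} (hf : Nat.Primrec' f) :
    GraphTestable fun v => Part.some (f v) := by
  induction hf with
  | zero => exact fun κ _ o _ => (Testable.zero o).of_iff fun x => by simp
  | succ => exact fun κ _ o i => (Testable.succ o (i 0)).of_iff fun x => by simp
  | get j => exact fun κ _ o i => (Testable.eq o (i j)).of_iff fun x => by simp
  | comp g _ _ ihf ihg =>
    have := ihf.comp ihg
    simpa only [Vector.mOfFn_part_some, Part.bind_some] using this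
  | prec _ _ ihf ihg => exact ihf.prec ihg

theorem rfind {n : ℕ} {f : List.Vector ℕ (n + 1) → ℕ}
    (hf : GraphTestable fun v => Part.some (f v)) :
    GraphTestable fun v => Nat.rfind fun m => Part.some (f (m ::ᵥ v) = 0) := by
  intro κ _ o i
  have nonzero := Testable.exists_fin (κ := (κ ⊕ Fin 2) ⊕ Fin 1) (m := 2)
    (φ := fun y v => v 1 = v 0 + 1 ∧
      v 1 ∈ Part.some (f (y (.inl (.inr 0)) ::ᵥ List.Vector.ofFn (y ∘ .inl ∘ .inl ∘ i))))
    ((Testable.succ (.inr 1) (.inr 0)).and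
      (hf _ (.inr 1) (Fin.cons (.inl (.inl (.inr 0))) (Sum.inl ∘ Sum.inl ∘ Sum.inl ∘ i))))
  have search := Testable.forall_lt (T := fun x m => f (m ::ᵥ List.Vector.ofFn (x ∘ i)) ≠ 0)
    (nonzero.of_iff fun y => ?_) o
  · have found := Testable.exists_fin (κ := κ) (m := 1)
      (φ := fun x v => v 0 ∈ Part.some (f (x o ::ᵥ List.Vector.ofFn (x ∘ i))) ∧ v 0 = 0)
      ((hf _ (.inr 0) (Fin.cons (.inl o) (Sum.inl ∘ i))).and (.zero (.inr 0)))
    refine (found.and search).of_iff fun x => ?_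
    refine Iff.trans ?_ Nat.mem_rfind.symm
    constructor
    · rintro ⟨⟨v, hv, h₀⟩, h⟩
      exact ⟨by simp_all, fun hm => by simpa using h _ hm⟩
    · rintro ⟨h₀, h⟩
      exact ⟨⟨0, by simpa [eq_comm] using h₀⟩, fun m hm => by simpa using h hm⟩
  · simp only [Part.mem_some_iff]
    constructor
    · rintro ⟨v, hv, h⟩
      exact h ▸ hv ▸ Nat.succ_ne_zero _
    · intro h
      obtain ⟨a, ha⟩ := Nat.exists_eq_succ_of_ne_zero h
      exact ⟨![a, a + 1], rfl, ha.symm⟩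

theorem of_partrec' {n : ℕ} {f : List.Vector ℕ n →. ℕ} (hf : Nat.Partrec' f) :
    GraphTestable f := by
  induction hf with
  | prim hf => exact of_primrec' hf
  | comp g _ _ ihf ihg => exact ihf.comp ihg
  | rfind _ ihf => exact rfind ihf

end GraphTestable

end PartialRecursive

section UniversalMachine

open Relation Encodable

theorem GraphTestable.dom {n : ℕ} {f : List.Vector ℕ n → Part ℕ} (hf : GraphTestable f)
    {κ : Type} [Fintype κ] (i : Fin n → κ) :
    Testable fun x : κ → ℕ => (f (List.Vector.ofFn (x ∘ i))).Dom :=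
  (Testable.exists_fin (m := 1) (φ := fun x v => v 0 ∈ f (List.Vector.ofFn (x ∘ i)))
    (hf _ (Sum.inr 0) (Sum.inl ∘ i))).of_iff fun _ =>
      ⟨fun ⟨_, hv⟩ => hv.1, fun h => ⟨fun _ => _, Part.get_mem h⟩⟩

/-- Reading a letter `a` when register `1` encodes the list `l`: afterwards it encodes `a :: l`. -/
def PushLetter (k : ℕ) (d d' : RegConf (Fin 3)) : Prop :=
  ∃ a < k, d' = (d.1 ++ [a], ![0, Nat.pair (d.2 0 + a) (d.2 1) + 1, d.2 2])

theorem realizable_pushLetter : Realizable PushLetter := by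
  have cons_testable : GraphTestable fun v : List.Vector ℕ 2 =>
      Part.some (Nat.pair v.head v.tail.head + 1) :=
    .of_primrec' (.of_prim (Primrec.succ.comp (Primrec₂.natPair.comp Primrec.vector_head
      (Primrec.vector_head.comp Primrec.vector_tail))))
  have push := Realizable.assign (κ := Fin 3) 1 (φ := fun x v =>
    v ∈ Part.some (Nat.pair (x 0) (x 1) + 1)) (cons_testable _ (Sum.inr 0) ![Sum.inl 0, Sum.inl 1])
  have clear := Realizable.assign (κ := Fin 3) 0 (φ := fun _ v => v = 0) (.zero (Sum.inr 0))
  refine (((Realizable.read 0).comp push).comp clear).of_eq fun k d d' => ?_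
  have update_eq (a v : ℕ) : Function.update (Function.update (d.2 + Pi.single 0 a) 1 v) 0 0 =
      ![0, v, d.2 2] := by
    funext i
    fin_cases i <;> simp
  constructor
  · rintro ⟨_, ⟨_, ⟨a, ha, rfl⟩, v, hv, rfl⟩, _, rfl, rfl⟩
    refine ⟨a, ha, Prod.ext rfl ((update_eq a v).trans ?_)⟩
    simpa using hv
  · rintro ⟨a, ha, rfl⟩
    exact ⟨_, ⟨_, ⟨a, ha, rfl⟩, _, Part.mem_some _, rfl⟩, 0, rfl,
      Prod.ext rfl ((update_eq a _).trans (by simp)).symm⟩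

theorem reflTransGen_pushLetter {k e : ℕ} {d : RegConf (Fin 3)} :
    ReflTransGen (PushLetter k) ([], ![0, 0, e]) d ↔
      ∃ y : List ℕ, (∀ a ∈ y, a < k) ∧ d = (y, ![0, encode y.reverse, e]) := by
  constructor
  · intro h
    induction h with
    | refl => exact ⟨[], by simp⟩
    | tail _ h ih =>
      obtain ⟨y, hy, rfl⟩ := ih
      obtain ⟨a, ha, rfl⟩ := h
      exact ⟨y ++ [a], by simpa [or_imp, forall_and, ha] using hy, by simp [encode_list_cons]⟩
  · rintro ⟨y, hy, rfl⟩
    induction y using List.reverseRecOn with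
    | nil => exact .refl
    | append_singleton y a ih =>
      exact (ih fun b hb => hy b (by simp [hb])).tail
        ⟨a, hy a (by simp), by simp [encode_list_cons]⟩

/-- Register `1` is a stack onto which the input is read, register `2` holds the number of a
program. -/
theorem realizable_universal : Realizable fun k => Comp (ReflTransGen (PushLetter k)) fun d d' =>
    d' = d ∧ ((Denumerable.ofNat Nat.Partrec.Code (d.2 2)).eval
      (encode (Denumerable.ofNat (List ℕ) (d.2 1)).reverse)).Dom := by
  have universal : Partrec fun v : List.Vector ℕ 2 =>
      (Denumerable.ofNat Nat.Partrec.Code v.head).eval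
        (encode (Denumerable.ofNat (List ℕ) v.tail.head).reverse) :=
    Nat.Partrec.Code.eval_part.comp ((Computable.ofNat _).comp Computable.vector_head)
      (Computable.encode.comp (Computable.list_reverse.comp ((Computable.ofNat _).comp
        (Computable.vector_head.comp Computable.vector_tail))))
  exact realizable_pushLetter.star.comp
    ((GraphTestable.of_partrec' (Nat.Partrec'.of_part universal)).dom ![2, 1])

theorem LoopGraph.IsQuad.exists_code_to_automaton {V : Type u} [Primcodable V] {Γ : LoopGraph V}
    {p q r s : V} (hQ : Γ.IsQuad p q r s) :
    ∃ g : ℕ × Nat.Partrec.Code → ValenceCode V, Primrec g ∧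
      ∀ k c, ((g (k, c)).toAutomaton Γ k).language = reLanguage k c := by
  let π : Fin 3 ↪ Nat.Primes := Fin.valEmbedding.trans (Infinite.natEmbedding _)
  obtain ⟨R, hR, hRA⟩ := realizable_universal π
  have hn₀ : Primrec fun e : ℕ × Nat.Partrec.Code => primeCode π ![0, 0, encode e.2] :=
    (primrec₂_nat_pow.comp (Primrec.const (π 2 : ℕ)) (Primrec.encode.comp Primrec.snd)).of_eq
      fun e => by simp [primeCode, Fin.prod_univ_three]
  obtain ⟨g, hg, h⟩ := (hR.comp_primrec Primrec.fst).exists_valenceCode hQ hn₀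
  refine ⟨g, hg, fun k c => (h (k, c) k).trans (Set.ext fun x => ?_)⟩
  have code_iff (n : ℕ) := hRA k ([], ![0, 0, encode c]) (x.map Fin.val, n)
  simp only [Set.mem_ofPred_eq, code_iff]
  change _ ↔ (c.eval (encode (x.map Fin.val))).Dom
  constructor
  · rintro ⟨n, d, ⟨_, h, rfl, hd⟩, hn⟩
    obtain ⟨y, -, rfl⟩ := reflTransGen_pushLetter.1 h
    obtain rfl : x.map Fin.val = y := congrArg Prod.fst hn
    simpa using hd
  · intro hx
    exact ⟨_, _, ⟨_, reflTransGen_pushLetter.2 ⟨x.map Fin.val, by simp, rfl⟩, rfl,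
      by simpa using hx⟩, rfl⟩

end UniversalMachine

/-! ### Rewriting in presented monoids -/

section Rewriting

open Relation

variable {α : Type*}

/-- The replacement of one occurrence of `r.1` in a word by `r.2`, for some rule `r ∈ R`. -/
def Rewrites (R : Set (List α × List α)) (g g' : List α) : Prop :=
  ∃ u w, ∃ r ∈ R, g = u ++ r.1 ++ w ∧ g' = u ++ r.2 ++ w

/-- The rewriting rules of a monoid presentation: its relations, read in both directions. -/
def presentationRules (rels : FreeMonoid α → FreeMonoid α → Prop) : Set (List α × List α) :=
  {r | rels (.ofList r.1) (.ofList r.2) ∨ rels (.ofList r.2) (.ofList r.1)}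

theorem Rewrites.append {R : Set (List α × List α)} {g g' : List α} (h : Rewrites R g g')
    (a b : List α) : Rewrites R (a ++ g ++ b) (a ++ g' ++ b) := by
  obtain ⟨u, w, r, hr, rfl, rfl⟩ := h
  exact ⟨a ++ u, w ++ b, r, hr, by simp, by simp⟩

variable {rels : FreeMonoid α → FreeMonoid α → Prop}

instance symm_rewrites_presentationRules : Std.Symm (Rewrites (presentationRules rels)) where
  symm := fun _ _ ⟨u, w, r, hr, hg, hg'⟩ => ⟨u, w, r.swap, hr.symm, hg', hg⟩

theorem reflTransGen_rewrites_of_conGen {g g' : FreeMonoid α} (h : ConGen.Rel rels g g') :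
    ReflTransGen (Rewrites (presentationRules rels)) g.toList g'.toList := by
  induction h with
  | of g g' h => exact .single ⟨[], [], (g.toList, g'.toList), .inl h, by simp, by simp⟩
  | refl g => exact .refl
  | symm _ ih => exact ReflTransGen.stdSymm.symm _ _ ih
  | trans _ _ ih ih' => exact ih.trans ih'
  | @mul a b c d _ _ ih ih' =>
    have left := ih.lift (· ++ c.toList) fun _ _ h => h.append [] c.toList
    have right := ih'.lift (b.toList ++ ·) fun _ _ h => by simpa using h.append b.toList []
    exact left.trans right

theorem mk_eq_mk_of_rewrites {g g' : List α} (h : Rewrites (presentationRules rels) g g') :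
    PresentedMonoid.mk rels (.ofList g) = PresentedMonoid.mk rels (.ofList g') := by
  obtain ⟨u, w, r, hr, rfl, rfl⟩ := h
  have rule_eq : PresentedMonoid.mk rels (.ofList r.1) = PresentedMonoid.mk rels (.ofList r.2) :=
    hr.elim PresentedMonoid.mk_eq_mk_of_rel fun h => (PresentedMonoid.mk_eq_mk_of_rel h).symm
  simp only [FreeMonoid.ofList_append, map_mul, rule_eq]

end Rewriting

/-! ### Enumeration of the language of a valence automaton -/

section Enumeration

open Relation

theorem rePred_exists_of_primrecRel {α β : Type*} [Primcodable α] [Primcodable β]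
    {p : α → β → Prop} (hp : PrimrecRel p) : REPred fun a => ∃ b, p a b := by
  classical
  let check (a : α) (n : ℕ) : Option Unit :=
    (Encodable.decode (α := β) n).bind fun b => if p a b then some () else none
  have hcheck : Primrec₂ check :=
    Primrec.option_bind (Primrec.decode.comp Primrec.snd) <| Primrec.ite
      (hp.comp (Primrec.fst.comp Primrec.fst) Primrec.snd) (Primrec.const _) (Primrec.const _)
  refine (Partrec.dom_re (Partrec.rfindOpt hcheck.to_comp)).of_eq fun a => ?_
  rw [Nat.rfindOpt_dom]
  constructor
  · rintro ⟨n, u, hu⟩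
    obtain ⟨b, -, hb⟩ := Option.bind_eq_some_iff.1 hu
    exact ⟨b, (Option.ite_none_right_eq_some.1 hb).1⟩
  · rintro ⟨b, hb⟩
    exact ⟨Encodable.encode b, (), by simp [check, hb]⟩

theorem exists_code_of_rePred {α : Type*} [Primcodable α] {p : α → Prop} (hp : REPred p) :
    ∃ c : Nat.Partrec.Code, ∀ a, (c.eval (Encodable.encode a)).Dom ↔ p a := by
  obtain ⟨c, hc⟩ := Nat.Partrec.Code.exists_code.1 hp
  refine ⟨c, fun a => ?_⟩
  rw [hc]
  simp [Part.assert]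

theorem primrecRel_mem_list {α : Type*} [Primcodable α] :
    PrimrecRel fun (a : α) (l : List α) => a ∈ l :=
  (PrimrecRel.exists_mem_list Primrec.eq).swap.of_eq fun a l => by simp [Function.swap]

theorem primrecPred_mem_of_finite {α : Type*} [Primcodable α] {s : Set α} (hs : s.Finite) :
    PrimrecPred (· ∈ s) :=
  (primrecRel_mem_list.comp Primrec.id (Primrec.const hs.toFinset.toList)).of_eq fun a => by simp

theorem reflTransGen_exists_eq_iff {α β : Type*} {f : α → β → α} {a a' : α} :
    ReflTransGen (fun a a' => ∃ b, f a b = a') a a' ↔ ∃ l : List β, l.foldl f a = a' := by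
  constructor
  · intro h
    induction h with
    | refl => exact ⟨[], rfl⟩
    | tail _ h ih =>
      obtain ⟨l, rfl⟩ := ih
      obtain ⟨b, rfl⟩ := h
      exact ⟨l ++ [b], by simp⟩
  · rintro ⟨l, rfl⟩
    induction l generalizing a with
    | nil => exact .refl
    | cons b l ih => exact .head ⟨b, rfl⟩ ih

variable {V : Type u}

namespace LoopGraph

variable (Γ : LoopGraph V)

theorem finite_presentationRules [Finite V] : (presentationRules Γ.Rel).Finite := by
  let cancel (v : V) : List (V × Bool) × List (V × Bool) := ([(v, true), (v, false)], [])
  let comm (e : (V × Bool) × (V × Bool)) := ([e.1, e.2], [e.2, e.1])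
  have rel_finite : {r : List (V × Bool) × List (V × Bool) |
      Γ.Rel (.ofList r.1) (.ofList r.2)}.Finite := by
    refine ((Set.finite_range cancel).union (Set.finite_range comm)).subset ?_
    rintro ⟨g, g'⟩ (⟨v⟩ | ⟨v, w, s, t, -⟩)
    · exact .inl ⟨v, rfl⟩
    · exact .inr ⟨((v, s), (w, t)), rfl⟩
  exact rel_finite.union (rel_finite.preimage Prod.swap_injective.injOn)

theorem reflTransGen_rewrites_of_wordClass_eq {g g' : List (V × Bool)}
    (h : Γ.wordClass g = Γ.wordClass g') :
    ReflTransGen (Rewrites (presentationRules Γ.Rel)) g g' :=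
  reflTransGen_rewrites_of_conGen (PresentedMonoid.mk_eq_mk_iff.1 h)

end LoopGraph

namespace ValenceCode

/-- Configurations (state, input read so far, storage content) in which the storage content is
represented by a word. -/
abbrev WordConf (V : Type u) : Type u := ℕ × List ℕ × List (V × Bool)

/-- A step between configurations: an edge is taken, or the storage word is rewritten. -/
inductive WordStep (Γ : LoopGraph V) (A : ValenceCode V) : WordConf V → WordConf V → Prop
  | edge {p q : ℕ} {z : List ℕ} {g : List (V × Bool)} (he : (p, z, g, q) ∈ A.edges)
      (hq : q ≤ A.lastState) (y : List ℕ) (h : List (V × Bool)) :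
      WordStep Γ A (p, y, h) (q, y ++ z, h ++ g)
  | rewrite {g g' : List (V × Bool)} (hg : Rewrites (presentationRules Γ.Rel) g g') (p : ℕ)
      (y : List ℕ) : WordStep Γ A (p, y, g) (p, y, g')

variable {Γ : LoopGraph V} {A : ValenceCode V}

theorem exists_reflTransGen_wordStep {k : ℕ}
    {c : Fin (A.lastState + 1) × List (Fin k) × Γ.GraphMonoid}
    (h : ReflTransGen (A.toAutomaton Γ k).Step ((0 : Fin _), [], 1) c) :
    ∃ g, Γ.wordClass g = c.2.2 ∧
      ReflTransGen (WordStep Γ A) (0, [], []) (c.1.val, c.2.1.map Fin.val, g) := by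
  induction h with
  | refl => exact ⟨[], rfl, .refl⟩
  | @tail c c' _ hs ih =>
    obtain ⟨g, hg, hr⟩ := ih
    obtain ⟨y, n, ⟨g', hg', hn⟩, hy, hm⟩ := hs
    refine ⟨g ++ g', ?_, ?_⟩
    · rw [hm, Γ.wordClass_append, hg]
      exact congrArg _ hn.symm
    · rw [hy, List.map_append]
      exact hr.tail (.edge hg' (Nat.lt_succ_iff.1 c'.1.isLt) _ _)

theorem reflTransGen_step_of_wordStep {c : WordConf V}
    (h : ReflTransGen (WordStep Γ A) (0, [], []) c) {k : ℕ} (x : List (Fin k))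
    (hx : x.map Fin.val = c.2.1) : ∃ hc : c.1 < A.lastState + 1,
      ReflTransGen (A.toAutomaton Γ k).Step ((0 : Fin _), [], 1)
        ((⟨c.1, hc⟩ : Fin _), x, Γ.wordClass c.2.2) := by
  induction h generalizing x with
  | refl =>
    obtain rfl : x = [] := List.map_eq_nil_iff.1 hx
    exact ⟨Nat.succ_pos _, .refl⟩
  | tail _ hs ih =>
    cases hs with
    | edge he hq y h =>
      obtain ⟨x₁, x₂, rfl, h₁, rfl⟩ := List.map_eq_append_iff.1 hx
      obtain ⟨_, hr⟩ := ih x₁ h₁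
      exact ⟨Nat.lt_succ_of_le hq, hr.tail ⟨x₂, _, ⟨_, he, rfl⟩, rfl, Γ.wordClass_append _ _⟩⟩
    | rewrite hg p y =>
      obtain ⟨hc, hr⟩ := ih x hx
      have word_eq : Γ.wordClass _ = Γ.wordClass _ := mk_eq_mk_of_rewrites hg
      exact ⟨hc, by simpa only [word_eq] using hr⟩

theorem mem_language_toAutomaton_iff {k : ℕ} {x : List (Fin k)} :
    x ∈ (A.toAutomaton Γ k).language ↔
      ∃ q ∈ A.final, ReflTransGen (WordStep Γ A) (0, [], []) (q, x.map Fin.val, []) := by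
  constructor
  · rintro ⟨q, hq, h⟩
    obtain ⟨g, hg, hr⟩ := exists_reflTransGen_wordStep h
    have cancel := Γ.reflTransGen_rewrites_of_wordClass_eq (g := g) (g' := []) hg
    exact ⟨_, hq, hr.trans (cancel.lift (fun g => (_, _, g)) fun _ _ h => .rewrite h _ _)⟩
  · rintro ⟨q, hq, h⟩
    obtain ⟨_, hr⟩ := reflTransGen_step_of_wordStep h x rfl
    exact ⟨_, hq, hr⟩

/-- What may be chosen in a step: an edge, or a rewriting rule with the words to the left and to the
right of the place where it is applied. -/
abbrev Choice (V : Type u) : Type u :=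
  (ℕ × List ℕ × List (V × Bool) × ℕ) ⊕
    (List (V × Bool) × (List (V × Bool) × List (V × Bool)) × List (V × Bool))

variable (Γ A)

open Classical in
/-- The configuration after a choice; a choice that is not available has no effect. -/
noncomputable def choose (c : WordConf V) : Choice V → WordConf V
  | .inl e => if e ∈ A.edges ∧ e.2.2.2 ≤ A.lastState ∧ c.1 = e.1 then
      (e.2.2.2, c.2.1 ++ e.2.1, c.2.2 ++ e.2.2.1) else c
  | .inr e => if e.2.1 ∈ presentationRules Γ.Rel ∧ c.2.2 = e.1 ++ e.2.1.1 ++ e.2.2 then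
      (c.1, c.2.1, e.1 ++ e.2.1.2 ++ e.2.2) else c

theorem exists_choose_eq_iff {c c' : WordConf V} :
    (∃ e, choose Γ A c e = c') ↔ ReflGen (WordStep Γ A) c c' := by
  constructor
  · rintro ⟨e | e, rfl⟩ <;> rw [choose] <;> split_ifs with h
    · obtain ⟨p, y, g⟩ := c
      obtain ⟨he, hq, rfl⟩ := h
      exact .single (.edge he hq _ _)
    · exact .refl
    · obtain ⟨p, y, g⟩ := c
      obtain ⟨hr, rfl⟩ := h
      exact .single (.rewrite ⟨_, _, _, hr, rfl, rfl⟩ _ _)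
    · exact .refl
  · rintro (_ | h)
    · exact ⟨.inr ([], ([], c.2.2), []), by simp [choose]⟩
    · cases h with
      | edge he hq y h => exact ⟨.inl (_, _, _, _), if_pos ⟨he, hq, rfl⟩⟩
      | rewrite hg p y =>
        obtain ⟨u, w, r, hr, rfl, rfl⟩ := hg
        exact ⟨.inr (u, r, w), if_pos ⟨hr, rfl⟩⟩

theorem reflTransGen_wordStep_iff {c c' : WordConf V} :
    ReflTransGen (WordStep Γ A) c c' ↔ ∃ l : List (Choice V), l.foldl (choose Γ A) c = c' := by
  rw [← reflTransGen_exists_eq_iff, ← reflTransGen_reflGen]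
  simp only [exists_choose_eq_iff]

end ValenceCode

end Enumeration

namespace ValenceCode

open Relation

variable {V : Type u} [Primcodable V]

theorem primrec_edges : Primrec (edges : ValenceCode V → _) :=
  (Primrec.fst.comp Primrec.snd).comp (Primrec.of_equiv (e := equivProd V))

theorem primrec_lastState : Primrec (lastState : ValenceCode V → _) :=
  Primrec.fst.comp (Primrec.of_equiv (e := equivProd V))

theorem primrec_final : Primrec (final : ValenceCode V → _) :=
  (Primrec.snd.comp Primrec.snd).comp (Primrec.of_equiv (e := equivProd V))

variable (Γ : LoopGraph V)

theorem primrec₂_choose_inl : Primrec₂ fun (p : ValenceCode V × WordConf V)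
    (e : ℕ × List ℕ × List (V × Bool) × ℕ) => choose Γ p.1 p.2 (.inl e) := by
  classical
  let Args := (ValenceCode V × WordConf V) × ℕ × List ℕ × List (V × Bool) × ℕ
  have A : Primrec fun x : Args => x.1.1 := Primrec.fst.comp Primrec.fst
  have c : Primrec fun x : Args => x.1.2 := Primrec.snd.comp Primrec.fst
  have z : Primrec fun x : Args => x.2.2 := Primrec.snd.comp Primrec.snd
  have q := Primrec.snd.comp (Primrec.snd.comp z)
  exact Primrec.ite ((primrecRel_mem_list.comp Primrec.snd (primrec_edges.comp A)).and
    ((Primrec.nat_le.comp q (primrec_lastState.comp A)).and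
      (Primrec.eq.comp (Primrec.fst.comp c) (Primrec.fst.comp Primrec.snd))))
    (q.pair ((Primrec.list_append.comp (Primrec.fst.comp (Primrec.snd.comp c))
      (Primrec.fst.comp z)).pair (Primrec.list_append.comp (Primrec.snd.comp (Primrec.snd.comp c))
        (Primrec.fst.comp (Primrec.snd.comp z))))) c

variable [Finite V]

theorem primrec₂_choose_inr : Primrec₂ fun (p : ValenceCode V × WordConf V)
    (e : List (V × Bool) × (List (V × Bool) × List (V × Bool)) × List (V × Bool)) =>
    choose Γ p.1 p.2 (.inr e) := by
  classical
  let Args := (ValenceCode V × WordConf V) ×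
    List (V × Bool) × (List (V × Bool) × List (V × Bool)) × List (V × Bool)
  have c : Primrec fun x : Args => x.1.2 := Primrec.snd.comp Primrec.fst
  have u : Primrec fun x : Args => x.2.1 := Primrec.fst.comp Primrec.snd
  have r : Primrec fun x : Args => x.2.2.1 := Primrec.fst.comp (Primrec.snd.comp Primrec.snd)
  have w : Primrec fun x : Args => x.2.2.2 := Primrec.snd.comp (Primrec.snd.comp Primrec.snd)
  have word {s : Args → List (V × Bool)} (hs : Primrec s) :
      Primrec fun x => x.2.1 ++ s x ++ x.2.2.2 :=
    Primrec.list_append.comp (Primrec.list_append.comp u hs) w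
  exact Primrec.ite (((primrecPred_mem_of_finite Γ.finite_presentationRules).comp r).and
    (Primrec.eq.comp (Primrec.snd.comp (Primrec.snd.comp c)) (word (Primrec.fst.comp r))))
    ((Primrec.fst.comp c).pair ((Primrec.fst.comp (Primrec.snd.comp c)).pair
      (word (Primrec.snd.comp r)))) c

theorem primrec_choose :
    Primrec fun p : (ValenceCode V × WordConf V) × Choice V => choose Γ p.1.1 p.1.2 p.2 :=
  (Primrec.sumCasesOn Primrec.snd
    ((primrec₂_choose_inl Γ).comp (Primrec.fst.comp Primrec.fst) Primrec.snd).to₂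
    ((primrec₂_choose_inr Γ).comp (Primrec.fst.comp Primrec.fst) Primrec.snd).to₂).of_eq
    fun ⟨_, e⟩ => by cases e <;> rfl

theorem primrec₂_foldl_choose : Primrec₂ fun (A : ValenceCode V) (l : List (Choice V)) =>
    l.foldl (choose Γ A) (0, [], []) :=
  Primrec.list_foldl Primrec.snd (Primrec.const _) ((primrec_choose Γ).comp
    (((Primrec.fst.comp Primrec.fst).pair (Primrec.fst.comp Primrec.snd)).pair
      (Primrec.snd.comp Primrec.snd))).to₂

theorem rePred_exists_reflTransGen_wordStep : REPred fun p : ValenceCode V × List ℕ =>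
    ∃ q ∈ p.1.final, ReflTransGen (WordStep Γ p.1) (0, [], []) (q, p.2, []) := by
  have run : Primrec fun e : (ValenceCode V × List ℕ) × List (Choice V) =>
      e.2.foldl (choose Γ e.1.1) (0, [], []) :=
    (primrec₂_foldl_choose Γ).comp (Primrec.fst.comp Primrec.fst) Primrec.snd
  have accepts : PrimrecRel fun (p : ValenceCode V × List ℕ) (l : List (Choice V)) =>
      (l.foldl (choose Γ p.1) (0, [], [])).1 ∈ p.1.final ∧
        (l.foldl (choose Γ p.1) (0, [], [])).2 = (p.2, []) :=
    (primrecRel_mem_list.comp (Primrec.fst.comp run)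
      (primrec_final.comp (Primrec.fst.comp Primrec.fst))).and
      (Primrec.eq.comp (Primrec.snd.comp run)
        ((Primrec.snd.comp Primrec.fst).pair (Primrec.const [])))
  refine (rePred_exists_of_primrecRel accepts).of_eq fun p => ?_
  simp only [reflTransGen_wordStep_iff]
  exact ⟨fun ⟨l, hf, hl⟩ => ⟨_, hf, l, Prod.ext rfl hl⟩,
    fun ⟨q, hq, l, hl⟩ => ⟨l, by rwa [hl], by rw [hl]⟩⟩

theorem exists_automaton_to_code : ∃ f : ℕ → ValenceCode V → Nat.Partrec.Code, Computable₂ f ∧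
    ∀ k A, reLanguage k (f k A) = (A.toAutomaton Γ k).language := by
  obtain ⟨c, hc⟩ := exists_code_of_rePred (rePred_exists_reflTransGen_wordStep Γ)
  refine ⟨fun _ A => c.curry (Encodable.encode A), (Nat.Partrec.Code.primrec₂_curry.comp
    (Primrec.const c) (Primrec.encode.comp Primrec.snd)).to_comp, fun k A => Set.ext fun x => ?_⟩
  refine Iff.trans ?_ mem_language_toAutomaton_iff.symm
  change (Nat.Partrec.Code.eval _ _).Dom ↔ _
  rw [Nat.Partrec.Code.eval_curry, ← Encodable.encode_prod_val, hc]

end ValenceCode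

/-! ### Change of alphabet -/

namespace ValenceAutomaton

open Relation

variable {X : Type v} {Y : Type*} {M : Type w}

theorem map_mem_language_iff [Monoid M] {A : ValenceAutomaton X M} {B : ValenceAutomaton Y M}
    (ι : A.State ≃ B.State) {e : X → Y}
    (hedges : ∀ p x m q, (ι p, x.map e, m, ι q) ∈ B.edges ↔ (p, x, m, q) ∈ A.edges)
    (hinit : ι A.init = B.init) (hfinal : ∀ q, ι q ∈ B.final ↔ q ∈ A.final) {x : List X} :
    x.map e ∈ B.language ↔ x ∈ A.language := by
  have step_of_step (c : A.State × List X × M) (d : B.State × List Y × M)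
      (h : B.Step d (ι c.1, c.2.1.map e, c.2.2)) :
      ∃ c', A.Step c' c ∧ (ι c'.1, c'.2.1.map e, c'.2.2) = d := by
    obtain ⟨p, y, m⟩ := d
    obtain ⟨z, n, hz, hy, hm⟩ := h
    obtain ⟨x₁, x₂, hx, rfl, rfl⟩ := List.map_eq_append_iff.1 hy
    exact ⟨(ι.symm p, x₁, m), ⟨x₂, n, (hedges ..).1 (by simpa using hz), hx, hm⟩, by simp⟩
  constructor
  · rintro ⟨f, hf, h⟩
    obtain ⟨q, rfl⟩ := ι.surjective f
    have reach (d) (h : ReflTransGen B.Step d (ι q, x.map e, 1)) :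
        ∃ c, ReflTransGen A.Step c (q, x, 1) ∧ (ι c.1, c.2.1.map e, c.2.2) = d := by
      induction h using ReflTransGen.head_induction_on with
      | refl => exact ⟨_, .refl, rfl⟩
      | head hs _ ih =>
        obtain ⟨c, hc, rfl⟩ := ih
        obtain ⟨c', hc', rfl⟩ := step_of_step c _ hs
        exact ⟨c', hc.head hc', rfl⟩
    obtain ⟨⟨p, y, m⟩, hc, hd⟩ := reach _ h
    simp only [Prod.mk.injEq, ← hinit, ι.injective.eq_iff, List.map_eq_nil_iff] at hd
    obtain ⟨rfl, rfl, rfl⟩ := hd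
    exact ⟨q, (hfinal q).1 hf, hc⟩
  · rintro ⟨q, hq, h⟩
    refine ⟨ι q, (hfinal q).2 hq, ?_⟩
    rw [← hinit]
    exact h.lift (p := B.Step) (fun c => (ι c.1, c.2.1.map e, c.2.2)) fun c c' ⟨y, n, h₁, h₂, h₃⟩ =>
      ⟨y.map e, n, (hedges ..).2 h₁, by simp [h₂], h₃⟩

/-- The automaton that reads a word over `X` as the given automaton reads its image. -/
def comapLetters (B : ValenceAutomaton Y M) (e : X → Y) (he : Function.Injective e) :
    ValenceAutomaton X M where
  State := B.State
  finite_state := B.finite_state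
  edges := {a | (a.1, a.2.1.map e, a.2.2.1, a.2.2.2) ∈ B.edges}
  finite_edges := by
    refine B.finite_edges.preimage (f := fun a : B.State × List X × M × B.State =>
      (a.1, a.2.1.map e, a.2.2.1, a.2.2.2)) (Function.Injective.injOn ?_)
    rintro ⟨p, x, m, q⟩ ⟨p', x', m', q'⟩ h
    simp only [Prod.mk.injEq] at h
    obtain ⟨rfl, hx, rfl, rfl⟩ := h
    rw [List.map_injective_iff.2 he hx]
  init := B.init
  final := B.final

theorem mem_language_comapLetters [Monoid M] (B : ValenceAutomaton Y M) {e : X → Y}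
    (he : Function.Injective e) {x : List X} :
    x ∈ (B.comapLetters e he).language ↔ x.map e ∈ B.language :=
  (map_mem_language_iff (A := B.comapLetters e he) (B := B) (e := e) (Equiv.refl B.State)
    (fun _ _ _ _ => Iff.rfl) rfl fun _ => Iff.rfl).symm

theorem exists_equiv_fin (A : ValenceAutomaton X M) :
    ∃ n, ∃ ι : A.State ≃ Fin (n + 1), ι A.init = 0 := by
  have := A.finite_state
  obtain ⟨n, ⟨ε⟩⟩ := Finite.exists_equiv_fin A.State
  cases n with
  | zero => exact (ε A.init).elim0
  | succ n => exact ⟨n, ε.trans (Equiv.swap (ε A.init) 0), by simp⟩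

end ValenceAutomaton

namespace LoopGraph

variable {V : Type u} (Γ : LoopGraph V)

theorem wordClass_surjective : Function.Surjective Γ.wordClass := fun m =>
  (PresentedMonoid.surjective_mk m).imp' FreeMonoid.toList fun _ h => h

theorem exists_valenceCode {X : Type v} {k : ℕ} {e : X → Fin k} (he : Function.Injective e)
    (A : ValenceAutomaton X Γ.GraphMonoid) :
    ∃ c : ValenceCode V, ∀ x : List X,
      x.map e ∈ (c.toAutomaton Γ k).language ↔ x ∈ A.language := by
  have := A.finite_state
  obtain ⟨n, ι, hι⟩ := A.exists_equiv_fin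
  choose rep hrep using Γ.wordClass_surjective
  let c : ValenceCode V :=
    { lastState := n
      edges := A.finite_edges.toFinset.toList.map fun a =>
        ((ι a.1).val, (a.2.1.map e).map Fin.val, rep a.2.2.1, (ι a.2.2.2).val)
      final := A.final.toFinite.toFinset.toList.map fun q => (ι q).val }
  have mem_edges (p : A.State) (x : List X) (m : Γ.GraphMonoid) (q : A.State) :
      (ι p, x.map e, m, ι q) ∈ c.edgeSet Γ k ↔ (p, x, m, q) ∈ A.edges := by
    have map_eq_iff (y : List X) : (y.map e).map Fin.val = (x.map e).map Fin.val ↔ y = x :=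
      ((List.map_injective_iff.2 Fin.val_injective).comp (List.map_injective_iff.2 he)).eq_iff
    simp only [ValenceCode.edgeSet, Set.mem_ofPred_eq, c, List.mem_map, Finset.mem_toList,
      Set.Finite.mem_toFinset, Prod.exists, Prod.mk.injEq, Fin.val_inj, ι.injective.eq_iff,
      map_eq_iff]
    constructor
    · rintro ⟨_, ⟨p', x', m', q', h, rfl, rfl, rfl, rfl⟩, rfl⟩
      rwa [hrep]
    · exact fun h => ⟨_, ⟨_, _, _, _, h, rfl, rfl, rfl, rfl⟩, (hrep m).symm⟩
  have mem_final (q : A.State) : (ι q).val ∈ c.final ↔ q ∈ A.final := by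
    simp [c, Fin.val_inj]
  exact ⟨c, fun x => ValenceAutomaton.map_mem_language_iff (B := c.toAutomaton Γ k) ι mem_edges hι
    mem_final⟩

end LoopGraph

theorem encode_list_map_encode {X : Type v} [Encodable X] (x : List X) :
    Encodable.encode (x.map Encodable.encode) = Encodable.encode x := by
  induction x with
  | nil => rfl
  | cons a x ih => simp [Encodable.encode_list_cons, ih]

theorem exists_injective_val_eq_encode (X : Type v) [Finite X] [Encodable X] :
    ∃ (k : ℕ) (e : X → Fin k), Function.Injective e ∧ ∀ a, (e a).val = Encodable.encode a := by
  obtain ⟨k, hk⟩ := (Set.finite_range (Encodable.encode : X → ℕ)).bddAbove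
  exact ⟨k + 1, fun a => ⟨Encodable.encode a, Nat.lt_succ_of_le (hk ⟨a, rfl⟩)⟩,
    fun _ _ h => Encodable.encode_injective (congrArg Fin.val h), fun _ => rfl⟩

theorem exists_map_mem_reLanguage_iff (X : Type v) [Finite X] [Encodable X] :
    ∃ (k : ℕ) (e : X → Fin k), Function.Injective e ∧
      ∀ (c : Nat.Partrec.Code) (x : List X),
        x.map e ∈ reLanguage k c ↔ (c.eval (Encodable.encode x)).Dom := by
  obtain ⟨k, e, he, hval⟩ := exists_injective_val_eq_encode X
  refine ⟨k, e, he, fun c x => ?_⟩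
  change (c.eval (Encodable.encode ((x.map e).map Fin.val))).Dom ↔ _
  rw [List.map_map, show Fin.val ∘ e = Encodable.encode from funext hval, encode_list_map_encode]

section Effective

variable {V : Type u} [Primcodable V] {Γ : LoopGraph V} {g : ℕ × Nat.Partrec.Code → ValenceCode V}

theorem VA_eq_setOf_rePred [Finite V]
    (hg : ∀ k c, ((g (k, c)).toAutomaton Γ k).language = reLanguage k c)
    (X : Type v) [Finite X] [Primcodable X] :
    VA Γ.GraphMonoid X = {L : Language X | REPred fun x : List X => x ∈ L} := by
  obtain ⟨k, e, he, hcode⟩ := exists_map_mem_reLanguage_iff X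
  ext L
  constructor
  · rintro ⟨A, rfl⟩
    obtain ⟨c, hc⟩ := Γ.exists_valenceCode he A
    obtain ⟨f, -, hf⟩ := ValenceCode.exists_automaton_to_code Γ
    refine (Partrec.dom_re (Nat.Partrec.Code.eval_part.comp (Computable.const (f k c))
      Computable.encode)).of_eq fun x => ?_
    rw [← hc, ← hf, hcode]
  · intro hL
    obtain ⟨c, hc⟩ := exists_code_of_rePred hL
    refine ⟨((g (k, c)).toAutomaton Γ k).comapLetters e he, Set.ext fun x => ?_⟩
    refine (ValenceAutomaton.mem_language_comapLetters _ he).trans ?_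
    rw [hg, hcode, hc]
    rfl

theorem not_computablePred_language_eq_empty (hgc : Computable g)
    (hg : ∀ k c, ((g (k, c)).toAutomaton Γ k).language = reLanguage k c) (k : ℕ) :
    ¬ ComputablePred fun A : ValenceCode V =>
      (A.toAutomaton Γ k).language = (∅ : Set (List (Fin k))) := by
  intro h
  refine ComputablePred.halting_problem 0 ?_
  have computable_ignoreInput : Computable fun c : Nat.Partrec.Code => g (k, c.comp .zero) :=
    hgc.comp ((Computable.const k).pair (Nat.Partrec.Code.primrec₂_comp.to_comp.comp Computable.id
      (Computable.const _)))
  refine (ComputablePred.computable_of_manyOneReducible (p := fun c => _)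
    ⟨_, computable_ignoreInput, fun _ => Iff.rfl⟩ h).not.of_eq fun c => ?_
  have eval_ignoreInput (n : ℕ) : (Nat.Partrec.Code.comp c .zero).eval n = c.eval 0 :=
    Part.bind_some 0 c.eval
  rw [hg]
  refine Iff.trans Set.nonempty_iff_ne_empty.symm ⟨?_, fun hc => ⟨[], ?_⟩⟩
  · rintro ⟨x, hx⟩
    exact eval_ignoreInput _ ▸ hx
  · exact (congrArg Part.Dom (eval_ignoreInput _)).mpr hc

end Effective

theorem mainTheorem2 {V : Type u} [Finite V] [Primcodable V] (Γ : LoopGraph V)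
    (hΓ : (SimpleGraph.cycleGraph 4).IsIndContained Γ.deleteLoops ∨
      (SimpleGraph.pathGraph 4).IsIndContained Γ.deleteLoops) :
    -- over every finite alphabet, `VA(𝕄Γ)` is the class of recursively enumerable languages
    (∀ (X : Type v) [Finite X] [Primcodable X],
      VA Γ.GraphMonoid X = {L : Language X | REPred fun x : List X => x ∈ L}) ∧
    -- both inclusions are effective, uniformly in the size `k` of the alphabet
    (∃ f : ℕ → ValenceCode V → Nat.Partrec.Code, Computable₂ f ∧
      ∀ k A, reLanguage k (f k A) = (A.toAutomaton Γ k).language) ∧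
    (∃ g : ℕ → Nat.Partrec.Code → ValenceCode V, Computable₂ g ∧
      ∀ k c, ((g k c).toAutomaton Γ k).language = reLanguage k c) ∧
    -- emptiness is undecidable, also for every fixed alphabet
    (¬ ComputablePred fun p : ℕ × ValenceCode V =>
      (p.2.toAutomaton Γ p.1).language = (∅ : Set (List (Fin p.1)))) ∧
    (∀ k : ℕ, ¬ ComputablePred fun A : ValenceCode V =>
      (A.toAutomaton Γ k).language = (∅ : Set (List (Fin k)))) := by
  obtain ⟨p, q, r, s, hQ⟩ := Γ.exists_isQuad hΓ
  obtain ⟨g, hgc, hg⟩ := hQ.exists_code_to_automaton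
  have undecidable := not_computablePred_language_eq_empty hgc.to_comp hg
  refine ⟨fun X _ _ => VA_eq_setOf_rePred hg X, ValenceCode.exists_automaton_to_code Γ,
    ⟨fun k c => g (k, c), hgc.to_comp, hg⟩, fun h => undecidable 0 ?_, undecidable⟩
  exact ComputablePred.computable_of_manyOneReducible
    ⟨fun A => (0, A), (Computable.const 0).pair Computable.id, fun _ => Iff.rfl⟩ h
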